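/- Let $\Phi$ be a (reduced, crystallographic) irreducible simply-laced root system in a finite-dimensional real vector space, with simple roots $\alpha_1,\dots,\alpha_r$, positive roots $\Phi^+$, simple reflections $\sigma_1,\dots,\sigma_r$ and Weyl group $W$. Call $i$ and $j$ adjacent if $i\ne j$ and $(\sigma_i\sigma_j)^3=1$. Let $q>0$ be a real number and $F=\mathbb C(x_1,\dots,x_r)$. For $\mathbf x=(x_1,\dots,x_r)$ define $\sigma_i\mathbf x=\mathbf x'$ and $\epsilon_i\mathbf x=\mathbf x''$ by $$x'_j=\begin{cases} x_ix_j\sqrt q & i,j \text{ adjacent},\\ 1/(qx_j) & j=i,\\ x_j&\text{otherwise,}\end{cases}\qquad x''_j=\begin{cases} -x_j & i,j \text{ adjacent},\\ x_j&\text{otherwise,}\end{cases}$$ and for $f\in F$ put $f_i^{\pm}(\mathbf x)=\tfrac12\bigl(f(\mathbf x)\pm f(\epsilon_i\mathbf x)\bigr)$ and $$(f|\sigma_i)(\mathbf x)=-\frac{1-qx_i}{qx_i(1-x_i)}\,f_i^+(\sigma_i\mathbf x)+\frac1{x_i\sqrt q}\,f_i^-(\sigma_i\mathbf x).$$ For a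 root $\alpha=\sum_j k_j\alpha_j$ write $d(\alpha)=\sum_j k_j$ and $\mathbf x^{\alpha}=\prod_j x_j^{k_j}$, and let $\Delta(\mathbf x)=\prod_{\alpha\in\Phi^+}\bigl(1-q^{d(\alpha)}\mathbf x^{2\alpha}\bigr)$. Then $\mathbf x\mapsto\sigma_i\mathbf x$ extends to a left action $\mathbf x\mapsto w\mathbf x$ of $W$ by substitutions, so that $f((vw)\mathbf x)=f(v(w\mathbf x))$ for all $f\in F$ and $v,w\in W$; the operations $f\mapsto f|\sigma_i$ extend to a right action $f\mapsto f|w$ of $W$ on $F$, so that $f|(vw)=(f|v)|w$. (Both extensions are unique, since the $\sigma_i$ generate $W$.) Put $j(w,\mathbf x)=\Delta(\mathbf x)/\Delta(w\mathbf x)$. The rational function $$f(\mathbf x)=\Delta(\mathbf x)^{-1}\sum_{w\in W}j(w,\mathbf x)\,(1|w)(\mathbf x)\in F$$ has the following properties. 1. $f|w=f$ for all $w\in W$. 2. For each $i$, the restriction of $f$ to the subspace $\{x_j=0 \text{ for all } j \text{ adjacent to } i\}$ is defined (that is, $f$ has a denominator that does not vanish identically on it), and on this subspace $f(\mathbf x)(1-x_i)$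 does not depend on $x_i$. 3. $f$ is regular at the origin and $f(0,\dots,0)=1$. In particular, there is an $f\in F$ that is invariant under this action of $W$ and satisfies 2 and 3. -/

import Mathlib

open MvPolynomial

noncomputable section

namespace WeylInv

/-! ### Rational functions in variables indexed by a finite type -/

section RationalFunctions

/-- The field `ℂ(x_i : i ∈ σ)` of rational functions. -/
abbrev RatFun (σ : Type*) : Type _ := FractionRing (MvPolynomial σ ℂ)

/-- A complex constant, as a rational function. -/
abbrev cst {σ : Type*} (c : ℂ) : RatFun σ := algebraMap ℂ (RatFun σ) c

/-- A polynomial, as a rational function. -/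
abbrev ofPoly {σ : Type*} (p : MvPolynomial σ ℂ) : RatFun σ :=
  algebraMap (MvPolynomial σ ℂ) (RatFun σ) p

/-- The coordinate function `x_i`. -/
def coord {σ : Type*} (i : σ) : RatFun σ := ofPoly (X i)

/-- The rational function `f` is regular at the point `p ∈ ℂ^σ`, and `f(p) = c`. -/
def HasValueAt {σ : Type*} (f : RatFun σ) (p : σ → ℂ) (c : ℂ) : Prop :=
  ∃ a b : MvPolynomial σ ℂ, eval p b ≠ 0 ∧ f = ofPoly a / ofPoly b ∧ c = eval p a / eval p b

open Classical in
/-- Set `x_j = 0` for all `j ∈ Z` in a polynomial. -/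
def setZero {σ : Type*} (Z : Set σ) : MvPolynomial σ ℂ →ₐ[ℂ] MvPolynomial σ ℂ :=
  aeval fun j => if j ∈ Z then 0 else X j

/-- Setting `x_j = 0` for all `j ∈ Z` in the rational function `f` is meaningful (that is, `f` can
be written with a denominator that does not vanish identically on this coordinate subspace), and
the result is the rational function `g` (in which the `x_j` with `j ∈ Z` do not occur). -/
def HasRestriction {σ : Type*} (Z : Set σ) (f g : RatFun σ) : Prop :=
  ∃ a b : MvPolynomial σ ℂ, setZero Z b ≠ 0 ∧ f = ofPoly a / ofPoly b ∧
    g = ofPoly (setZero Z a) / ofPoly (setZero Z b)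

/-- `g` does not depend on `x_i`: it lies in the field `ℂ(x_k : k ≠ i)`. -/
def IndepOf {σ : Type*} (i : σ) (g : RatFun σ) : Prop :=
  g ∈ IntermediateField.adjoin ℂ (coord '' {k : σ | k ≠ i})

/-- Substitution: for `y = (y_j)` algebraically independent rational functions, `f ↦ f(y)`. -/
def subst {σ : Type*} (y : σ → RatFun σ) (hy : AlgebraicIndependent ℂ y) :
    RatFun σ →ₐ[ℂ] RatFun σ :=
  IsFractionRing.liftAlgHom (A := MvPolynomial σ ℂ) (g := aeval y)
    (algebraicIndependent_iff_injective_aeval.mp hy)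

lemma subst_ofPoly {σ : Type*} (y : σ → RatFun σ) (hy : AlgebraicIndependent ℂ y)
    (p : MvPolynomial σ ℂ) : subst y hy (ofPoly p) = aeval y p := by
  rw [subst, ofPoly, IsFractionRing.liftAlgHom_apply]
  exact IsFractionRing.lift_algebraMap _ p

lemma subst_coord {σ : Type*} (y : σ → RatFun σ) (hy : AlgebraicIndependent ℂ y) (j : σ) :
    subst y hy (coord j) = y j := by
  rw [coord, subst_ofPoly, aeval_X]

lemma coord_ne_zero {σ : Type*} (i : σ) : (coord i : RatFun σ) ≠ 0 := by
  simp [coord, ofPoly, MvPolynomial.X_ne_zero]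

lemma algebraicIndependent_of_isAlgebraic {σ : Type*} [Finite σ] (y : σ → RatFun σ)
    (h : ∀ j, IsAlgebraic (Algebra.adjoin ℂ (Set.range y)) (coord j : RatFun σ)) :
    AlgebraicIndependent ℂ y := by
  have hp : ∀ p : MvPolynomial σ ℂ,
      IsAlgebraic (Algebra.adjoin ℂ (Set.range y)) (ofPoly p : RatFun σ) := by
    intro p
    induction p using MvPolynomial.induction_on with
    | C c =>
      have : (ofPoly (C c) : RatFun σ)
          = algebraMap (Algebra.adjoin ℂ (Set.range y)) (RatFun σ) (algebraMap ℂ _ c) := by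
        rw [← IsScalarTower.algebraMap_apply, ofPoly, ← MvPolynomial.algebraMap_eq,
          ← IsScalarTower.algebraMap_apply]
      rw [this]; exact isAlgebraic_algebraMap _
    | add p q hp hq => simpa [ofPoly] using hp.add hq
    | mul_X p j hp => simpa [ofPoly, coord] using hp.mul (h j)
  have : Algebra.IsAlgebraic (Algebra.adjoin ℂ (Set.range y)) (RatFun σ) := by
    refine ⟨fun f => ?_⟩
    obtain ⟨a, b, -, rfl⟩ := IsFractionRing.div_surjective (A := MvPolynomial σ ℂ) f
    rw [div_eq_mul_inv]
    exact (hp a).mul (hp b).inv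
  have hX : AlgebraicIndependent ℂ (coord : σ → RatFun σ) := by
    have := (MvPolynomial.algebraicIndependent_X σ ℂ).map'
      (f := IsScalarTower.toAlgHom ℂ (MvPolynomial σ ℂ) (RatFun σ))
      (IsFractionRing.injective (MvPolynomial σ ℂ) (RatFun σ))
    exact this
  exact (Algebra.IsAlgebraic.isTranscendenceBasis_of_le_trdeg_of_finite ℂ y hX.cardinalMk_le_trdeg).1

end RationalFunctions

/-! ### The operators attached to a vertex `i` of a graph with adjacency relation `adj` -/

section Operators

open Classical in
/-- The coordinates of `σ_i x`. -/
def sigmaPt {σ : Type*} (adj : σ → σ → Prop) (q : ℝ) (i : σ) (j : σ) : RatFun σ :=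
  if j = i then 1 / (cst q * coord i)
  else if adj i j then coord i * coord j * cst (√q : ℝ)
  else coord j

open Classical in
/-- The coordinates of `ε_i x`. -/
def epsPt {σ : Type*} (adj : σ → σ → Prop) (i : σ) (j : σ) : RatFun σ :=
  if adj i j then -coord j else coord j

lemma cst_ne_zero {σ : Type*} {c : ℂ} (hc : c ≠ 0) : (cst c : RatFun σ) ≠ 0 := by
  simpa [cst] using hc

lemma isAlgebraic_cst {σ : Type*} (y : σ → RatFun σ) (c : ℂ) :
    IsAlgebraic (Algebra.adjoin ℂ (Set.range y)) (cst c : RatFun σ) := by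
  rw [cst, IsScalarTower.algebraMap_apply ℂ (Algebra.adjoin ℂ (Set.range y)) (RatFun σ)]
  exact isAlgebraic_algebraMap _

lemma isAlgebraic_pt {σ : Type*} (y : σ → RatFun σ) (j : σ) :
    IsAlgebraic (Algebra.adjoin ℂ (Set.range y)) (y j) :=
  isAlgebraic_algebraMap
    (⟨y j, Algebra.subset_adjoin (Set.mem_range_self j)⟩ : Algebra.adjoin ℂ (Set.range y))

lemma algebraicIndependent_sigmaPt {σ : Type*} [Finite σ] (adj : σ → σ → Prop) {q : ℝ}
    (hq : 0 < q) (i : σ) : AlgebraicIndependent ℂ (sigmaPt adj q i) := by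
  have hq' : (cst (q : ℂ) : RatFun σ) ≠ 0 := cst_ne_zero (by exact_mod_cast hq.ne')
  have hs : (cst ((√q : ℝ) : ℂ) : RatFun σ) ≠ 0 :=
    cst_ne_zero (by exact_mod_cast (Real.sqrt_pos.2 hq).ne')
  have hi : IsAlgebraic (Algebra.adjoin ℂ (Set.range (sigmaPt adj q i)))
      (coord i : RatFun σ) := by
    have e : (coord i : RatFun σ) = (cst (q : ℂ) * sigmaPt adj q i i)⁻¹ := by
      have := coord_ne_zero i
      simp only [sigmaPt, if_true]
      field_simp
    rw [e]
    exact ((isAlgebraic_cst _ _).mul (isAlgebraic_pt _ i)).inv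
  refine algebraicIndependent_of_isAlgebraic _ fun j => ?_
  by_cases hj : j = i
  · rwa [hj]
  by_cases ha : adj i j
  · have e : (coord j : RatFun σ)
        = sigmaPt adj q i j * (coord i * cst ((√q : ℝ) : ℂ))⁻¹ := by
      have := coord_ne_zero i
      simp only [sigmaPt, if_neg hj, if_pos ha]
      field_simp
    rw [e]
    exact (isAlgebraic_pt _ j).mul (hi.mul (isAlgebraic_cst _ _)).inv
  · have e : (coord j : RatFun σ) = sigmaPt adj q i j := by
      simp only [sigmaPt, if_neg hj, if_neg ha]
    rw [e]
    exact isAlgebraic_pt _ j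

lemma algebraicIndependent_epsPt {σ : Type*} [Finite σ] (adj : σ → σ → Prop) (i : σ) :
    AlgebraicIndependent ℂ (epsPt adj i) := by
  refine algebraicIndependent_of_isAlgebraic _ fun j => ?_
  by_cases ha : adj i j
  · have e : (coord j : RatFun σ) = -epsPt adj i j := by
      simp only [epsPt, if_pos ha, neg_neg]
    rw [e]
    exact (isAlgebraic_pt _ j).neg
  · have e : (coord j : RatFun σ) = epsPt adj i j := by
      simp only [epsPt, if_neg ha]
    rw [e]
    exact isAlgebraic_pt _ j

/-- `f ↦ f(σ_i x)`. -/
def sigmaSub {σ : Type*} [Finite σ] (adj : σ → σ → Prop) {q : ℝ} (hq : 0 < q) (i : σ) :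
    RatFun σ →ₐ[ℂ] RatFun σ :=
  subst (sigmaPt adj q i) (algebraicIndependent_sigmaPt adj hq i)

/-- `f ↦ f(ε_i x)`. -/
def epsSub {σ : Type*} [Finite σ] (adj : σ → σ → Prop) (i : σ) : RatFun σ →ₐ[ℂ] RatFun σ :=
  subst (epsPt adj i) (algebraicIndependent_epsPt adj i)

/-- `f_i^+`. -/
def plusPart {σ : Type*} [Finite σ] (adj : σ → σ → Prop) (i : σ) (f : RatFun σ) : RatFun σ :=
  (f + epsSub adj i f) / 2

/-- `f_i^-`. -/
def minusPart {σ : Type*} [Finite σ] (adj : σ → σ → Prop) (i : σ) (f : RatFun σ) : RatFun σ :=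
  (f - epsSub adj i f) / 2

/-- `f | σ_i`. -/
def slash {σ : Type*} [Finite σ] (adj : σ → σ → Prop) {q : ℝ} (hq : 0 < q) (i : σ)
    (f : RatFun σ) : RatFun σ :=
  -((1 - cst q * coord i) / (cst q * coord i * (1 - coord i)))
      * sigmaSub adj hq i (plusPart adj i f)
    + 1 / (coord i * cst (√q : ℝ)) * sigmaSub adj hq i (minusPart adj i f)

end Operators

/-! ### Root systems -/

section RootSystems

/-- The reflection `σ_i` in the simple root `α_i`, as an element of the Weyl group. -/
def simpleReflection {ι V N : Type*} [AddCommGroup V] [Module ℝ V] [AddCommGroup N] [Module ℝ N]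
    {P : RootPairing ι ℝ V N} (b : P.Base) (i : b.support) : P.weylGroup :=
  RootPairing.weylGroup.ofIdx P i

/-- The indices `i` and `j` of simple roots are adjacent. -/
def Adjacent {ι V N : Type*} [AddCommGroup V] [Module ℝ V] [AddCommGroup N] [Module ℝ N]
    {P : RootPairing ι ℝ V N} (b : P.Base) (i j : b.support) : Prop :=
  i ≠ j ∧ (simpleReflection b i * simpleReflection b j) ^ 3 = 1

/-- The coefficient `k_j` of `α_j` in a root `α = ∑ j, k_j α_j`. -/
def rootCoeff {ι V N : Type*} [AddCommGroup V] [Module ℝ V] [AddCommGroup N] [Module ℝ N]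
    {P : RootPairing ι ℝ V N} (b : P.Base) (a : ι) (j : b.support) : ℤ :=
  b.toWeightBasisInt.repr (P.rootSpanMem ℤ a) j

open Classical in
/-- `Δ(x) = ∏_{α > 0} (1 - q^{d(α)} x^{2α})`, where `d(α)` is the height of `α`. -/
def bigDelta {ι V N : Type*} [Fintype ι] [AddCommGroup V] [Module ℝ V] [AddCommGroup N]
    [Module ℝ N] {P : RootPairing ι ℝ V N} (b : P.Base) (q : ℝ) : RatFun b.support :=
  ∏ a : ι with b.IsPos a,
    (1 - cst q ^ b.height a * ∏ j : b.support, coord j ^ (2 * rootCoeff b a j))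

/-- The Weyl group of a finite root system is finite, so that sums over it make sense. -/
instance finite_weylGroup {ι V N : Type*} [Finite ι] [AddCommGroup V] [Module ℝ V]
    [AddCommGroup N] [Module ℝ N] (P : RootPairing ι ℝ V N) [P.IsRootSystem] :
    Finite P.weylGroup := by
  refine Finite.of_injective (fun w => P.weylGroupToPerm w) fun v w h => ?_
  apply Subtype.ext
  apply RootPairing.Equiv.weightHom_injective P
  apply LinearEquiv.toLinearMap_injective
  refine LinearMap.ext_on_range (v := P.root) (RootPairing.IsRootSystem.span_root_eq_top) ?_
  intro a
  have hv : v • P.root a = P.root (P.weylGroupToPerm v a) := P.weylGroup_apply_root v a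
  have hw : w • P.root a = P.root (P.weylGroupToPerm w a) := P.weylGroup_apply_root w a
  have : v • P.root a = w • P.root a := by rw [hv, hw]; exact congrArg _ (DFunLike.congr_fun h a)
  exact this

end RootSystems

end WeylInv

end

noncomputable section

set_option linter.unusedSectionVars false

namespace WeylInv


/-! ### Simple reflections generate the Weyl group, with the Coxeter relations -/

section WeylGroup

variable {ι V N : Type*} [AddCommGroup V] [Module ℝ V] [AddCommGroup N] [Module ℝ N]
  {P : RootPairing ι ℝ V N}

/-! In the normalised coordinates y_j = √q x_j all powers of q disappear. Writing y^α = √q^{d(α)}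
x^α, the substitution σ_i sends y^α to y^{σ_i α}, ε_i multiplies y^α by (-1)^⟨α, α_i^∨⟩, and Δ = ∏
(1 - y^{2α}) over α > 0.

Both actions exist because W is presented by its Coxeter relations
(`exists_monoidHom_of_coxeter_relations`, proved by comparing reduced words). The substitutions
satisfy these relations because reflections do. For the slash operators the braid relation is an
identity of rational functions, `slashForm_braid`.

Invariance: each T_w Δ is even under every ε_i, so it factors out of the slash operators, and f is
just the sum over w of Δ⁻¹|w (`average_eq`). Acting by v permutes the summands.

Properties 2 and 3: Δ = -y_i² · σ_i Δ, so the terms h(w) = j(w, x) (1|w) satisfy h(1) = 1 and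
h(vσ_i) = -y_i² (h(v)|σ_i). Following a reduced word, h(w) becomes a fraction with denominator ∏ (q
- y^{2α}) over the inversions α of w, whose numerator is a combination of monomials containing every
such y^α to a positive power (`exists_inversion_list`). So h(w) vanishes on {x_j = 0, j ∈ Z} as soon
as an inversion of w involves Z, that is, unless w lies in the parabolic subgroup on the complement
of Z. On this subspace only the parabolic sum survives (`hasRestriction_average`).

At the origin only h(1) = 1 is left. For Z the neighbours of i, the parabolic subgroup is W_J ×
⟨σ_i⟩ with J the non-neighbours of i, and h(u) + h(uσ_i) = (1 - y_i²)/(1 - x_i) · h(u) for u ∈ W_J.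
The factor 1 - y_i² cancels the factor of Δ at α_i, and nothing else involves x_i apart from the 1 -
x_i in the denominator. -/

lemma weylGroupToPerm_ofIdx (a : ι) :
    P.weylGroupToPerm (RootPairing.weylGroup.ofIdx P a) = P.reflectionPerm a :=
  RootPairing.Equiv.reflection_indexEquiv P a

lemma weylGroupToPerm_injective [P.IsRootSystem] : Function.Injective P.weylGroupToPerm := by
  intro v w h
  apply Subtype.ext
  apply RootPairing.Equiv.weightHom_injective P
  apply LinearEquiv.toLinearMap_injective
  refine LinearMap.ext_on_range (v := P.root) (RootPairing.IsRootSystem.span_root_eq_top) ?_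
  intro a
  have hv : v • P.root a = P.root (P.weylGroupToPerm v a) := P.weylGroup_apply_root v a
  have hw : w • P.root a = P.root (P.weylGroupToPerm w a) := P.weylGroup_apply_root w a
  have : v • P.root a = w • P.root a := by rw [hv, hw]; exact congrArg _ (DFunLike.congr_fun h a)
  exact this

lemma ofIdx_mul_self [P.IsRootSystem] (a : ι) :
    RootPairing.weylGroup.ofIdx P a * RootPairing.weylGroup.ofIdx P a = 1 := by
  apply weylGroupToPerm_injective
  rw [map_mul, map_one, weylGroupToPerm_ofIdx, ← sq, P.reflectionPerm_sq]

lemma conj_ofIdx_ofIdx [P.IsRootSystem] (a c : ι) :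
    RootPairing.weylGroup.ofIdx P a * RootPairing.weylGroup.ofIdx P c *
      RootPairing.weylGroup.ofIdx P a = RootPairing.weylGroup.ofIdx P (P.reflectionPerm a c) := by
  apply weylGroupToPerm_injective
  rw [map_mul, map_mul]
  simp only [weylGroupToPerm_ofIdx]
  ext d
  apply P.root.injective
  simp only [Equiv.Perm.mul_apply, P.root_reflectionPerm, P.reflection_reflectionPerm,
    LinearEquiv.mul_apply]

lemma mul_ofIdx_mul_inv [P.IsRootSystem] (w : P.weylGroup) (a : ι) :
    w * RootPairing.weylGroup.ofIdx P a * w⁻¹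
      = RootPairing.weylGroup.ofIdx P (P.weylGroupToPerm w a) := by
  obtain ⟨w, hw⟩ := w
  induction hw using RootPairing.weylGroup.induction generalizing a with
  | mem c =>
    have h := conj_ofIdx_ofIdx (P := P) c a
    have hi : (RootPairing.weylGroup.ofIdx P c)⁻¹ = RootPairing.weylGroup.ofIdx P c :=
      inv_eq_of_mul_eq_one_left (ofIdx_mul_self (P := P) c)
    change RootPairing.weylGroup.ofIdx P c * _ * (RootPairing.weylGroup.ofIdx P c)⁻¹
      = RootPairing.weylGroup.ofIdx P (P.weylGroupToPerm (RootPairing.weylGroup.ofIdx P c) a)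
    rw [hi, h, weylGroupToPerm_ofIdx]
  | one =>
    change (1 : P.weylGroup) * _ * (1 : P.weylGroup)⁻¹
      = RootPairing.weylGroup.ofIdx P (P.weylGroupToPerm (1 : P.weylGroup) a)
    simp
  | mul x y hx hy hx' hy' =>
    have e : (⟨x * y, mul_mem hx hy⟩ : P.weylGroup) = ⟨x, hx⟩ * ⟨y, hy⟩ := rfl
    rw [e, map_mul, Equiv.Perm.mul_apply, ← hx', ← hy']
    group

lemma weylGroupToPerm_neg (w : P.weylGroup) (a : ι) :
    P.weylGroupToPerm w (P.reflectionPerm a a)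
      = P.reflectionPerm (P.weylGroupToPerm w a) (P.weylGroupToPerm w a) := by
  apply P.root.injective
  rw [← P.weylGroup_apply_root, P.root_reflectionPerm, P.root_reflectionPerm,
    RootPairing.reflection_apply_self, RootPairing.reflection_apply_self, smul_neg,
    P.weylGroup_apply_root]

variable (b : P.Base)

lemma weylGroupToPerm_simpleReflection (i : b.support) :
    P.weylGroupToPerm (simpleReflection b i) = P.reflectionPerm i :=
  weylGroupToPerm_ofIdx _

lemma simpleReflection_mul_self [P.IsRootSystem] (i : b.support) :
    simpleReflection b i * simpleReflection b i = 1 := ofIdx_mul_self _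

lemma simpleReflection_inv [P.IsRootSystem] (i : b.support) :
    (simpleReflection b i)⁻¹ = simpleReflection b i :=
  inv_eq_of_mul_eq_one_left (simpleReflection_mul_self b i)

lemma mul_simpleReflection_cancel [P.IsRootSystem] (w : P.weylGroup) (i : b.support) :
    w * simpleReflection b i * simpleReflection b i = w := by
  rw [mul_assoc, simpleReflection_mul_self, mul_one]

lemma isPos_neg_iff (a : ι) : b.IsPos (P.reflectionPerm a a) ↔ ¬ b.IsPos a :=
  RootPairing.Base.IsPos.neg_iff_not b a

lemma isPos_mul_simpleReflection_iff (w : P.weylGroup) (i : b.support) :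
    b.IsPos (P.weylGroupToPerm (w * simpleReflection b i) i)
      ↔ ¬ b.IsPos (P.weylGroupToPerm w i) := by
  rw [map_mul, Equiv.Perm.mul_apply, weylGroupToPerm_simpleReflection, weylGroupToPerm_neg,
    isPos_neg_iff]

variable [Finite ι] [P.IsRootSystem] [P.IsCrystallographic] [P.IsReduced]

/-- Every root arises from simple roots by negation and simple reflections. By `conj_ofIdx_ofIdx`
each such step conjugates the corresponding reflection. -/
lemma closure_simpleReflection :
    Subgroup.closure (Set.range (simpleReflection b)) = ⊤ := by
  have key : ∀ a : ι, RootPairing.weylGroup.ofIdx P a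
      ∈ Subgroup.closure (Set.range (simpleReflection b)) := by
    intro a
    refine b.induction_reflect a (p := fun a => RootPairing.weylGroup.ofIdx P a
      ∈ Subgroup.closure (Set.range (simpleReflection b))) (fun a ha => ?_) (fun a ha => ?_)
      (fun a j ha hj => ?_)
    · rw [← conj_ofIdx_ofIdx]
      exact mul_mem (mul_mem ha ha) ha
    · exact Subgroup.subset_closure ⟨⟨a, ha⟩, rfl⟩
    · rw [← conj_ofIdx_ofIdx]
      have hj' : RootPairing.weylGroup.ofIdx P j
          ∈ Subgroup.closure (Set.range (simpleReflection b)) :=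
        Subgroup.subset_closure ⟨⟨j, hj⟩, rfl⟩
      exact mul_mem (mul_mem hj' ha) hj'
  rw [eq_top_iff]
  rintro ⟨w, hw⟩ -
  induction hw using RootPairing.weylGroup.induction with
  | mem c => exact key c
  | one => exact one_mem _
  | mul x y hx hy hx' hy' => exact mul_mem hx' hy'

lemma exists_word (w : P.weylGroup) :
    ∃ l : List b.support, (l.map (simpleReflection b)).prod = w := by
  have hw : w ∈ Subgroup.closure (Set.range (simpleReflection b)) := by
    rw [closure_simpleReflection]; trivial
  induction hw using Subgroup.closure_induction with
  | mem x hx => obtain ⟨i, rfl⟩ := hx; exact ⟨[i], by simp⟩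
  | one => exact ⟨[], rfl⟩
  | mul x y _ _ hx hy =>
    obtain ⟨l, rfl⟩ := hx
    obtain ⟨l', rfl⟩ := hy
    exact ⟨l ++ l', by simp⟩
  | inv x _ hx =>
    obtain ⟨l, rfl⟩ := hx
    refine ⟨l.reverse, ?_⟩
    rw [List.prod_inv_reverse, List.map_map, List.map_reverse]
    congr 3
    funext i
    exact (simpleReflection_inv b i).symm

/-- Letting the word act on α_i from its right end, some letter k first turns a positive root uα_i
negative. Then uα_i = α_k, so σ_k u = uσ_i, and deleting this letter has the same effect as
multiplying by σ_i on the right. -/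
lemma exchange (l : List b.support) (i : b.support)
    (h : ¬ b.IsPos (P.weylGroupToPerm (l.map (simpleReflection b)).prod i)) :
    ∃ l' : List b.support, l'.length + 1 = l.length ∧
      (l'.map (simpleReflection b)).prod
        = (l.map (simpleReflection b)).prod * simpleReflection b i := by
  induction l with
  | nil => exact absurd (RootPairing.Base.isPos_of_mem_support i.2) (by simpa using h)
  | cons k l ih =>
    by_cases hl : b.IsPos (P.weylGroupToPerm (l.map (simpleReflection b)).prod i)
    · refine ⟨l, rfl, ?_⟩
      rw [List.map_cons, List.prod_cons] at h ⊢
      set u := (l.map (simpleReflection b)).prod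
      -- The only positive root made negative by σ_k is α_k.
      have hk : P.weylGroupToPerm u i = k := by
        by_contra hne
        rw [map_mul, Equiv.Perm.mul_apply, weylGroupToPerm_simpleReflection] at h
        exact h (hl.reflectionPerm k.2 hne)
      have e : simpleReflection b k = u * simpleReflection b i * u⁻¹ := by
        rw [simpleReflection, ← hk, ← mul_ofIdx_mul_inv]; rfl
      rw [e, inv_mul_cancel_right, mul_simpleReflection_cancel]
    · obtain ⟨l', hl', hp⟩ := ih hl
      exact ⟨k :: l', by simp [hl'], by simp [hp, mul_assoc]⟩

open Classical in
/-- The length of an element of the Weyl group, as a word in the simple reflections. -/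
def wordLength (w : P.weylGroup) : ℕ :=
  Nat.find (p := fun n => ∃ l : List b.support, l.length = n ∧
    (l.map (simpleReflection b)).prod = w)
    (let ⟨l, hl⟩ := exists_word b w; ⟨l.length, l, rfl, hl⟩)

lemma exists_reduced_word (w : P.weylGroup) :
    ∃ l : List b.support, l.length = wordLength b w ∧ (l.map (simpleReflection b)).prod = w := by
  classical
  exact Nat.find_spec (p := fun n => ∃ l : List b.support, l.length = n ∧
    (l.map (simpleReflection b)).prod = w) _

lemma wordLength_le (l : List b.support) :
    wordLength b (l.map (simpleReflection b)).prod ≤ l.length := by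
  classical
  exact Nat.find_min' _ ⟨l, rfl, rfl⟩

lemma wordLength_mul_le (w : P.weylGroup) (i : b.support) :
    wordLength b (w * simpleReflection b i) ≤ wordLength b w + 1 := by
  obtain ⟨l, hl, rfl⟩ := exists_reduced_word b w
  rw [← hl]
  simpa using wordLength_le b (l ++ [i])

lemma wordLength_mul_of_not_isPos {w : P.weylGroup} {i : b.support}
    (h : ¬ b.IsPos (P.weylGroupToPerm w i)) :
    wordLength b (w * simpleReflection b i) + 1 = wordLength b w := by
  have h1 := wordLength_mul_le b (w * simpleReflection b i) i
  rw [mul_simpleReflection_cancel] at h1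
  obtain ⟨l, hl, rfl⟩ := exists_reduced_word b w
  obtain ⟨l', hl', hp⟩ := exchange b l i h
  have h2 := wordLength_le b l'
  rw [hp] at h2
  omega

lemma wordLength_mul_of_isPos {w : P.weylGroup} {i : b.support}
    (h : b.IsPos (P.weylGroupToPerm w i)) :
    wordLength b (w * simpleReflection b i) = wordLength b w + 1 := by
  have := wordLength_mul_of_not_isPos b (w := w * simpleReflection b i) (i := i)
    (by rwa [isPos_mul_simpleReflection_iff, not_not])
  rw [mul_simpleReflection_cancel] at this
  exact this.symm

/-- The last letter of a reduced word is a descent: otherwise dropping it would leave a word too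
short for its product. -/
lemma exists_descent {w : P.weylGroup} (hw : w ≠ 1) :
    ∃ i : b.support, ¬ b.IsPos (P.weylGroupToPerm w i) := by
  obtain ⟨l, hl, rfl⟩ := exists_reduced_word b w
  induction l using List.reverseRecOn with
  | nil => exact absurd rfl hw
  | append_singleton l i _ =>
    refine ⟨i, fun hpos => ?_⟩
    have h1 := wordLength_mul_of_isPos b hpos
    rw [List.map_append, List.prod_append, List.map_singleton, List.prod_singleton,
      mul_simpleReflection_cancel] at h1
    have h2 := wordLength_le b l
    simp only [List.length_append, List.length_singleton, List.map_append, List.prod_append,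
      List.map_singleton, List.prod_singleton] at hl
    omega

/-- Induction on the Weyl group along reduced words. -/
lemma weylGroup_induction {p : P.weylGroup → Prop} (one : p 1)
    (step : ∀ v (i : b.support), b.IsPos (P.weylGroupToPerm v i) → p v →
      p (v * simpleReflection b i)) (w : P.weylGroup) : p w := by
  induction hn : wordLength b w using Nat.strong_induction_on generalizing w with
  | _ n ih =>
    by_cases hw : w = 1
    · rwa [hw]
    · obtain ⟨i, hi⟩ := exists_descent b hw
      have hl := wordLength_mul_of_not_isPos b hi
      have := step (w * simpleReflection b i) i
        (by rwa [isPos_mul_simpleReflection_iff]) (ih _ (by omega) _ rfl)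
      rwa [mul_simpleReflection_cancel] at this

end WeylGroup


/-! ### Lifting the Coxeter relations in the simply-laced case -/

section Lifting

variable {ι V N : Type*} [AddCommGroup V] [Module ℝ V] [AddCommGroup N] [Module ℝ N]
  {P : RootPairing ι ℝ V N} [P.IsCrystallographic] (b : P.Base)

lemma root_reflectionPerm_int (a c : ι) :
    P.root (P.reflectionPerm a c) = P.root c - P.pairingIn ℤ c a • P.root a := by
  rw [P.root_reflectionPerm, P.reflection_apply_root' ℤ]

lemma reflectionPerm_of_pairingIn_eq_zero {a c : ι} (h : P.pairingIn ℤ c a = 0) :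
    P.reflectionPerm a c = c := by
  apply P.root.injective
  rw [root_reflectionPerm_int, h, zero_smul, sub_zero]

lemma reflectionPerm_of_pairingIn_eq_neg_one {a c : ι} (h : P.pairingIn ℤ c a = -1)
    (h' : P.pairingIn ℤ a c = -1) : P.reflectionPerm a c = P.reflectionPerm c a := by
  apply P.root.injective
  rw [root_reflectionPerm_int, root_reflectionPerm_int, h, h']
  module

variable [Finite ι] [P.IsRootSystem]

lemma pairingIn_cases (hsl : b.cartanMatrix.IsSimplyLaced) {i j : b.support} (hij : i ≠ j) :
    (P.pairingIn ℤ i j = 0 ∧ P.pairingIn ℤ j i = 0) ∨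
      (P.pairingIn ℤ i j = -1 ∧ P.pairingIn ℤ j i = -1) := by
  have h1 : P.pairingIn ℤ i j = 0 ∨ P.pairingIn ℤ i j = -1 := hsl hij
  have h2 : P.pairingIn ℤ j i = 0 ∨ P.pairingIn ℤ j i = -1 := hsl hij.symm
  have h3 : P.pairingIn ℤ i j = 0 ↔ P.pairingIn ℤ j i = 0 :=
    b.cartanMatrix_apply_eq_zero_iff_symm (i := i) (j := j)
  omega

/-- For orthogonal simple roots the reflections commute, so (σ_iσ_j)³ = 1 would collapse to σ_iσ_j =
1. But σ_iσ_j sends α_i to -α_i. -/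
lemma adjacent_iff (hsl : b.cartanMatrix.IsSimplyLaced) {i j : b.support} :
    Adjacent b i j ↔ P.pairingIn ℤ i j = -1 := by
  constructor
  · rintro ⟨hij, h3⟩
    refine ((pairingIn_cases b hsl hij).resolve_left fun ⟨h, h'⟩ => ?_).1
    have hc : simpleReflection b i * simpleReflection b j * simpleReflection b i
        = simpleReflection b j := by
      refine (conj_ofIdx_ofIdx _ _).trans ?_
      rw [reflectionPerm_of_pairingIn_eq_zero h', simpleReflection]
    have h1 : simpleReflection b i * simpleReflection b j = 1 := by
      rw [← h3, pow_succ, pow_two, ← mul_assoc (simpleReflection b i * simpleReflection b j), hc,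
        simpleReflection_mul_self, one_mul]
    have h2 := congrArg (fun w => P.root (P.weylGroupToPerm w i)) h1
    simp only [map_mul, map_one, Equiv.Perm.mul_apply, Equiv.Perm.one_apply,
      weylGroupToPerm_simpleReflection, reflectionPerm_of_pairingIn_eq_zero h] at h2
    rw [P.root_reflectionPerm, RootPairing.reflection_apply_self] at h2
    have h4 : (2 : ℝ) • P.root i = 0 := by
      rw [two_smul]
      nth_rewrite 1 [← h2]
      exact neg_add_cancel _
    exact P.ne_zero i ((smul_eq_zero.mp h4).resolve_left two_ne_zero)
  · intro h
    have hij : i ≠ j := by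
      rintro rfl
      rw [P.pairingIn_same] at h
      omega
    have h' : P.pairingIn ℤ j i = -1 := by
      have := pairingIn_cases b hsl hij
      omega
    refine ⟨hij, ?_⟩
    have hb : simpleReflection b i * simpleReflection b j * simpleReflection b i
        = simpleReflection b j * simpleReflection b i * simpleReflection b j := by
      refine (conj_ofIdx_ofIdx _ _).trans
        (Eq.trans ?_ (conj_ofIdx_ofIdx (j : ι) (i : ι)).symm)
      rw [reflectionPerm_of_pairingIn_eq_neg_one h' h]
    have e : (simpleReflection b i * simpleReflection b j) ^ 3
        = (simpleReflection b i * simpleReflection b j * simpleReflection b i)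
          * (simpleReflection b j * simpleReflection b i * simpleReflection b j) := by
      simp only [pow_succ, pow_zero, one_mul, mul_assoc]
    rw [e, ← hb]
    simp only [mul_assoc]
    rw [← mul_assoc (simpleReflection b i) (simpleReflection b i), simpleReflection_mul_self,
      one_mul, ← mul_assoc (simpleReflection b j) (simpleReflection b j),
      simpleReflection_mul_self, one_mul, simpleReflection_mul_self]

lemma pairingIn_of_not_adjacent (hsl : b.cartanMatrix.IsSimplyLaced) {i j : b.support}
    (hij : i ≠ j) (h : ¬ Adjacent b i j) : P.pairingIn ℤ i j = 0 ∧ P.pairingIn ℤ j i = 0 := by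
  rw [adjacent_iff b hsl] at h
  have := pairingIn_cases b hsl hij
  omega

lemma pairingIn_of_adjacent (hsl : b.cartanMatrix.IsSimplyLaced) {i j : b.support}
    (h : Adjacent b i j) : P.pairingIn ℤ i j = -1 ∧ P.pairingIn ℤ j i = -1 := by
  have hij := h.1
  rw [adjacent_iff b hsl] at h
  have := pairingIn_cases b hsl hij
  omega

lemma simpleReflection_comm {i j : b.support} (h : P.pairingIn ℤ j i = 0) :
    simpleReflection b i * simpleReflection b j
      = simpleReflection b j * simpleReflection b i := by
  have hc : simpleReflection b i * simpleReflection b j * simpleReflection b i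
      = simpleReflection b j := by
    refine (conj_ofIdx_ofIdx _ _).trans ?_
    rw [reflectionPerm_of_pairingIn_eq_zero h, simpleReflection]
  nth_rewrite 2 [← hc]
  rw [mul_simpleReflection_cancel]

lemma simpleReflection_braid {i j : b.support} (h : P.pairingIn ℤ j i = -1)
    (h' : P.pairingIn ℤ i j = -1) :
    simpleReflection b i * simpleReflection b j * simpleReflection b i
      = simpleReflection b j * simpleReflection b i * simpleReflection b j := by
  refine (conj_ofIdx_ofIdx _ _).trans
    (Eq.trans ?_ (conj_ofIdx_ofIdx (j : ι) (i : ι)).symm)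
  rw [reflectionPerm_of_pairingIn_eq_neg_one h h']

/-- Here σ_i α_j = α_i + α_j, and height is additive, so a sum of two negative roots is negative. -/
lemma not_isPos_reflectionPerm {a : ι} {w : P.weylGroup} {i j : b.support}
    (h : P.pairingIn ℤ j i = -1) (ha : a = P.reflectionPerm i j)
    (hi : ¬ b.IsPos (P.weylGroupToPerm w i)) (hj : ¬ b.IsPos (P.weylGroupToPerm w j)) :
    ¬ b.IsPos (P.weylGroupToPerm w a) := by
  have hr : P.root (P.weylGroupToPerm w a)
      = P.root (P.weylGroupToPerm w i) + P.root (P.weylGroupToPerm w j) := by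
    simp only [← P.weylGroup_apply_root, ← smul_add]
    rw [ha, root_reflectionPerm_int, h]
    congr 1
    module
  rw [RootPairing.Base.isPos_iff'] at *
  rw [b.height_add hr]
  omega

/-- `LiftRel b S w m` says that `m` is the product of the `S i` along a reduced word for `w`. -/
inductive LiftRel {M : Type*} [Monoid M] (S : b.support → M) : P.weylGroup → M → Prop
  | one : LiftRel S 1 1
  | step {v : P.weylGroup} {i : b.support} {m : M} (h : b.IsPos (P.weylGroupToPerm v i))
      (hm : LiftRel S v m) : LiftRel S (v * simpleReflection b i) (m * S i)

variable {b} {M : Type*} [Monoid M] {S : b.support → M}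

lemma LiftRel.of_descent {w : P.weylGroup} {i : b.support} {m : M}
    (h : ¬ b.IsPos (P.weylGroupToPerm w i)) (hm : LiftRel b S (w * simpleReflection b i) m) :
    LiftRel b S w (m * S i) := by
  have := LiftRel.step (by rwa [isPos_mul_simpleReflection_iff]) hm
  rwa [mul_simpleReflection_cancel] at this

lemma LiftRel.eq_one_or {w : P.weylGroup} {m : M} (h : LiftRel b S w m) :
    (w = 1 ∧ m = 1) ∨ ∃ (i : b.support) (m' : M), ¬ b.IsPos (P.weylGroupToPerm w i) ∧
      LiftRel b S (w * simpleReflection b i) m' ∧ m = m' * S i := by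
  cases h with
  | one => exact Or.inl ⟨rfl, rfl⟩
  | @step v i m h hm =>
    refine Or.inr ⟨i, m, ?_, ?_, rfl⟩
    · rwa [isPos_mul_simpleReflection_iff, not_not]
    · rwa [mul_simpleReflection_cancel]

variable [P.IsReduced]

variable (S) in
lemma LiftRel.exists (w : P.weylGroup) : ∃ m, LiftRel b S w m := by
  refine weylGroup_induction b (p := fun w => ∃ m, LiftRel b S w m) ⟨1, .one⟩ ?_ w
  rintro v i hi ⟨m, hm⟩
  exact ⟨_, hm.step hi⟩

omit [P.IsReduced] in
lemma isPos_one_apply (i : b.support) : b.IsPos (P.weylGroupToPerm 1 i) := by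
  simpa using RootPairing.Base.isPos_of_mem_support i.2

/-- Matsumoto's argument, by induction on length. If reduced words for w end in different letters i
and j, both are descents, so w also has reduced words ending in either expression of the longest
element of ⟨σ_i, σ_j⟩. Each given product is compared with one of these by induction, and the two
agree by the relation between `S i` and `S j`. -/
lemma LiftRel.unique (hsl : b.cartanMatrix.IsSimplyLaced)
    (hcomm : ∀ i j : b.support, i ≠ j → ¬ Adjacent b i j → S i * S j = S j * S i)
    (hbraid : ∀ i j : b.support, Adjacent b i j → S i * S j * S i = S j * S i * S j)
    {w : P.weylGroup} {m m' : M} (h : LiftRel b S w m) (h' : LiftRel b S w m') : m = m' := by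
  induction hn : wordLength b w using Nat.strong_induction_on generalizing w m m' with
  | _ n ih =>
    subst hn
    have ih' : ∀ {i : b.support} {m m' : M}, ¬ b.IsPos (P.weylGroupToPerm w i) →
        LiftRel b S (w * simpleReflection b i) m → LiftRel b S (w * simpleReflection b i) m' →
        m = m' := fun hi h h' =>
      ih _ (by have := wordLength_mul_of_not_isPos b hi; omega) h h' rfl
    obtain ⟨rfl, rfl⟩ | ⟨i, a, hi, ha, rfl⟩ := h.eq_one_or
    · obtain ⟨-, rfl⟩ | ⟨i, a, hi, -⟩ := h'.eq_one_or
      · rfl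
      · exact absurd (isPos_one_apply i) hi
    obtain ⟨rfl, rfl⟩ | ⟨j, c, hj, hc, rfl⟩ := h'.eq_one_or
    · exact absurd (isPos_one_apply i) hi
    by_cases hij : i = j
    · subst hij
      rw [ih' hi ha hc]
    by_cases hadj : Adjacent b i j
    · obtain ⟨p1, p2⟩ := pairingIn_of_adjacent b hsl hadj
      have key : ∀ {i j : b.support}, P.pairingIn ℤ i j = -1 → P.pairingIn ℤ j i = -1 →
          ¬ b.IsPos (P.weylGroupToPerm w i) → ¬ b.IsPos (P.weylGroupToPerm w j) → ∀ {d : M},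
          LiftRel b S (w * (simpleReflection b i * simpleReflection b j * simpleReflection b i)) d →
          LiftRel b S (w * simpleReflection b i) (d * S i * S j) := by
        intro i j p1 p2 hi hj d hd
        refine LiftRel.of_descent ?_ (LiftRel.of_descent ?_ (by simpa only [mul_assoc] using hd))
        · rw [map_mul, Equiv.Perm.mul_apply, weylGroupToPerm_simpleReflection]
          exact not_isPos_reflectionPerm b p2 rfl hi hj
        · rw [map_mul, Equiv.Perm.mul_apply, map_mul, Equiv.Perm.mul_apply,
            weylGroupToPerm_simpleReflection, weylGroupToPerm_simpleReflection,
            reflectionPerm_of_pairingIn_eq_neg_one p1 p2, P.reflectionPerm_self]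
          exact hj
      -- `d` belongs to w times the longest element σ_iσ_jσ_i of the dihedral subgroup. It is the
      -- common initial part of the two reduced words.
      obtain ⟨d, hd⟩ := LiftRel.exists S
        (w * (simpleReflection b i * simpleReflection b j * simpleReflection b i))
      have e1 := ih' hi ha (key p1 p2 hi hj hd)
      rw [simpleReflection_braid b p2 p1] at hd
      have e2 := ih' hj hc (key p2 p1 hj hi hd)
      rw [e1, e2]
      simpa only [mul_assoc] using congrArg (d * ·) (hbraid i j hadj)
    · obtain ⟨p1, p2⟩ := pairingIn_of_not_adjacent b hsl hij hadj
      obtain ⟨d, hd⟩ := LiftRel.exists S (w * (simpleReflection b i * simpleReflection b j))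
      have e1 : a = d * S j := by
        refine ih' hi ha (LiftRel.of_descent ?_ (by rwa [mul_assoc]))
        rw [map_mul, Equiv.Perm.mul_apply, weylGroupToPerm_simpleReflection,
          reflectionPerm_of_pairingIn_eq_zero p2]
        exact hj
      rw [simpleReflection_comm b p2] at hd
      have e2 : c = d * S i := by
        refine ih' hj hc (LiftRel.of_descent ?_ (by rwa [mul_assoc]))
        rw [map_mul, Equiv.Perm.mul_apply, weylGroupToPerm_simpleReflection,
          reflectionPerm_of_pairingIn_eq_zero p1]
        exact hi
      rw [e1, e2, mul_assoc, mul_assoc, hcomm i j hij hadj]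

/-- The Weyl group of a simply-laced root system is presented by the Coxeter relations. -/
theorem exists_monoidHom_of_coxeter_relations (hsl : b.cartanMatrix.IsSimplyLaced)
    (hsq : ∀ i, S i * S i = 1)
    (hcomm : ∀ i j : b.support, i ≠ j → ¬ Adjacent b i j → S i * S j = S j * S i)
    (hbraid : ∀ i j : b.support, Adjacent b i j → S i * S j * S i = S j * S i * S j) :
    ∃ φ : P.weylGroup →* M, ∀ i, φ (simpleReflection b i) = S i := by
  choose φ hφ using LiftRel.exists (b := b) S
  have hu : ∀ {w m}, LiftRel b S w m → φ w = m := fun h =>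
    LiftRel.unique hsl hcomm hbraid (hφ _) h
  have h1 : φ 1 = 1 := hu .one
  have hs : ∀ v i, φ (v * simpleReflection b i) = φ v * S i := by
    intro v i
    by_cases hi : b.IsPos (P.weylGroupToPerm v i)
    · exact hu ((hφ v).step hi)
    · rw [hu (LiftRel.of_descent hi (hφ (v * simpleReflection b i))), mul_assoc, hsq, mul_one]
  refine ⟨⟨⟨φ, h1⟩, fun v w => ?_⟩, fun i => ?_⟩
  · refine weylGroup_induction b (p := fun w => φ (v * w) = φ v * φ w) ?_ ?_ w
    · rw [mul_one, h1, mul_one]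
    · intro w i _ h
      rw [← mul_assoc, hs, h, hs, mul_assoc]
  · have := hs 1 i
    rwa [one_mul, h1, one_mul] at this

end Lifting


/-! ### Monomials attached to roots -/

section RootCoefficients

variable {ι V N : Type*} [AddCommGroup V] [Module ℝ V] [AddCommGroup N] [Module ℝ N]
  {P : RootPairing ι ℝ V N} (b : P.Base)

lemma root_eq_sum (a : ι) : P.root a = ∑ j : b.support, rootCoeff b a j • P.root j := by
  have h := congrArg (fun x : P.rootSpan ℤ => (x : V))
    (b.toWeightBasisInt.sum_repr (P.rootSpanMem ℤ a))
  simp only [Submodule.coe_sum, Submodule.coe_smul, b.coe_toWeightBasisInt_apply] at h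
  exact h.symm

lemma rootCoeff_unique {a : ι} {f : b.support → ℤ}
    (h : P.root a = ∑ j : b.support, f j • P.root j) : rootCoeff b a = f := by
  have hli : LinearIndependent ℤ (fun j : b.support => P.root j) :=
    b.linearIndepOn_root.restrict_scalars' ℤ
  funext j
  exact Fintype.linearIndependent_iffₛ.mp hli _ _ ((root_eq_sum b a).symm.trans h) j

lemma rootCoeff_simple [DecidableEq b.support] (i : b.support) :
    rootCoeff b i = Pi.single i 1 := by
  refine rootCoeff_unique b ?_
  simp [Pi.single_apply]

lemma height_eq_sum_rootCoeff (a : ι) : b.height a = ∑ j : b.support, rootCoeff b a j := by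
  classical
  let f : ι → ℤ := fun k => if h : k ∈ b.support then rootCoeff b a ⟨k, h⟩ else 0
  have hf : ∀ j : b.support, f j = rootCoeff b a j := fun j => by simp [f]
  have h : P.root a = ∑ j ∈ b.support, f j • P.root j := by
    rw [← Finset.sum_coe_sort, root_eq_sum b a]
    simp only [hf]
  rw [RootPairing.Base.height_eq_sum h, ← Finset.sum_coe_sort]
  simp only [hf]

lemma rootCoeff_nonneg {a : ι} (ha : b.IsPos a) (j : b.support) : 0 ≤ rootCoeff b a j := by
  obtain ⟨f, hf, hpos, hs⟩ := b.exists_root_eq_sum_int a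
  have e : rootCoeff b a = fun j : b.support => f j := by
    refine rootCoeff_unique b ?_
    rw [hs, ← Finset.sum_coe_sort]
  have hf0 : 0 < f := by
    refine hpos.resolve_right fun hneg => ?_
    rw [RootPairing.Base.isPos_iff, RootPairing.Base.height_eq_sum hs] at ha
    exact absurd ha (not_lt.mpr (Finset.sum_nonpos fun i _ => hneg.le i))
  rw [e]
  exact hf0.le j

lemma exists_rootCoeff_pos {a : ι} (ha : b.IsPos a) : ∃ j, 0 < rootCoeff b a j := by
  by_contra! h
  rw [RootPairing.Base.isPos_iff, height_eq_sum_rootCoeff] at ha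
  exact absurd ha (not_lt.mpr (Finset.sum_nonpos fun i _ => h i))

variable [P.IsCrystallographic]

lemma sum_rootCoeff_mul_pairingIn (a c : ι) :
    ∑ j : b.support, rootCoeff b a j * P.pairingIn ℤ j c = P.pairingIn ℤ a c := by
  apply FaithfulSMul.algebraMap_injective ℤ ℝ
  have h := congrArg (P.coroot' c) (root_eq_sum b a)
  simp only [map_sum, map_zsmul, RootPairing.root_coroot'_eq_pairing] at h
  rw [map_sum, RootPairing.algebraMap_pairingIn, h]
  refine Finset.sum_congr rfl fun j _ => ?_
  rw [map_mul, RootPairing.algebraMap_pairingIn, zsmul_eq_mul, eq_intCast]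

lemma rootCoeff_reflectionPerm [DecidableEq b.support] (a : ι) (i : b.support) :
    rootCoeff b (P.reflectionPerm i a)
      = rootCoeff b a + Pi.single i (-P.pairingIn ℤ a i) := by
  refine rootCoeff_unique b ?_
  rw [root_reflectionPerm_int]
  nth_rewrite 1 [root_eq_sum b a]
  simp [add_smul, Finset.sum_add_distrib, Pi.single_apply, sub_eq_add_neg]

lemma rootCoeff_reflectionPerm_self (a : ι) :
    rootCoeff b (P.reflectionPerm a a) = -rootCoeff b a := by
  refine rootCoeff_unique b ?_
  rw [P.root_reflectionPerm, RootPairing.reflection_apply_self, root_eq_sum b a]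
  simp

end RootCoefficients

/-! ### The substitutions in normalised coordinates. -/

section Substitutions

lemma ratFun_algHom_ext {σ : Type*} {φ ψ : RatFun σ →ₐ[ℂ] RatFun σ}
    (h : ∀ j, φ (coord j) = ψ (coord j)) : φ = ψ := by
  have h0 : φ.comp (IsScalarTower.toAlgHom ℂ (MvPolynomial σ ℂ) (RatFun σ))
      = ψ.comp (IsScalarTower.toAlgHom ℂ (MvPolynomial σ ℂ) (RatFun σ)) :=
    MvPolynomial.algHom_ext h
  apply AlgHom.coe_ringHom_injective
  apply IsLocalization.ringHom_ext (nonZeroDivisors (MvPolynomial σ ℂ))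
  exact RingHom.ext fun x => DFunLike.congr_fun h0 x

/-- The normalised coordinate `√q x_i`. -/
def ycoord {σ : Type*} (q : ℝ) (i : σ) : RatFun σ := cst (√q : ℝ) * coord i

lemma cst_sqrt_ne_zero {σ : Type*} {q : ℝ} (hq : 0 < q) :
    (cst ((√q : ℝ) : ℂ) : RatFun σ) ≠ 0 :=
  cst_ne_zero (by exact_mod_cast (Real.sqrt_pos.2 hq).ne')

lemma cst_sqrt_sq {σ : Type*} {q : ℝ} (hq : 0 < q) :
    (cst ((√q : ℝ) : ℂ) : RatFun σ) ^ 2 = cst (q : ℂ) := by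
  rw [cst, ← map_pow, ← Complex.ofReal_pow, Real.sq_sqrt hq.le]

lemma ycoord_ne_zero {σ : Type*} {q : ℝ} (hq : 0 < q) (i : σ) : ycoord q i ≠ 0 :=
  mul_ne_zero (cst_sqrt_ne_zero hq) (coord_ne_zero i)

lemma coord_eq_ycoord {σ : Type*} {q : ℝ} (hq : 0 < q) (i : σ) :
    coord i = ycoord q i / cst (√q : ℝ) := by
  rw [ycoord, mul_div_cancel_left₀ _ (cst_sqrt_ne_zero hq)]

lemma ratFun_algHom_ext' {σ : Type*} {q : ℝ} (hq : 0 < q) {φ ψ : RatFun σ →ₐ[ℂ] RatFun σ}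
    (h : ∀ j, φ (ycoord q j) = ψ (ycoord q j)) : φ = ψ := by
  refine ratFun_algHom_ext fun j => ?_
  simp only [coord_eq_ycoord hq, map_div₀, h, cst, AlgHom.commutes]

variable {ι V N : Type*} [AddCommGroup V] [Module ℝ V] [AddCommGroup N] [Module ℝ N]
  {P : RootPairing ι ℝ V N} (b : P.Base)

lemma zpow_sum_eq_prod {K α : Type*} [Field K] {x : K} (hx : x ≠ 0) (s : Finset α) (f : α → ℤ) :
    x ^ (∑ j ∈ s, f j) = ∏ j ∈ s, x ^ f j := by
  classical
  induction s using Finset.induction_on with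
  | empty => simp
  | insert j s hj ih => rw [Finset.sum_insert hj, zpow_add₀ hx, ih, Finset.prod_insert hj]

/-- The normalised monomial `√q ^ d(α) x^α` attached to a root. -/
def rootMon (q : ℝ) (a : ι) : RatFun b.support := ∏ j, ycoord q j ^ rootCoeff b a j

variable {q : ℝ} (hq : 0 < q)

lemma rootMon_simple (q : ℝ) (i : b.support) : rootMon b q i = ycoord q i := by
  classical
  rw [rootMon, rootCoeff_simple, Finset.prod_eq_single i]
  · simp
  · intro j _ hj; simp [hj]
  · simp

include hq in
lemma rootMon_ne_zero (a : ι) : rootMon b q a ≠ 0 :=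
  Finset.prod_ne_zero_iff.mpr fun _ _ => zpow_ne_zero _ (ycoord_ne_zero hq _)

lemma rootMon_neg (q : ℝ) [P.IsCrystallographic] (a : ι) :
    rootMon b q (P.reflectionPerm a a) = (rootMon b q a)⁻¹ := by
  simp [rootMon, rootCoeff_reflectionPerm_self, Finset.prod_inv_distrib]

variable [P.IsCrystallographic]

include hq in
lemma rootMon_reflectionPerm (i : b.support) (a : ι) :
    rootMon b q (P.reflectionPerm i a)
      = rootMon b q a * ycoord q i ^ (-P.pairingIn ℤ a i) := by
  classical
  simp only [rootMon, rootCoeff_reflectionPerm, Pi.add_apply,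
    zpow_add₀ (ycoord_ne_zero hq _), Finset.prod_mul_distrib]
  congr 1
  rw [Finset.prod_eq_single i]
  · simp
  · intro j _ hj; simp [hj]
  · simp

include hq in
lemma bigDelta_eq [Fintype ι] : (bigDelta b q : RatFun b.support)
    = open Classical in ∏ a : ι with b.IsPos a, (1 - rootMon b q a ^ 2) := by
  classical
  refine Finset.prod_congr rfl fun a _ => ?_
  congr 1
  rw [height_eq_sum_rootCoeff, rootMon, ← cst_sqrt_sq hq, ← zpow_natCast, ← zpow_mul,
    mul_comm ((2 : ℕ) : ℤ), zpow_mul, zpow_natCast, zpow_sum_eq_prod (cst_sqrt_ne_zero hq),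
    ← Finset.prod_pow, ← Finset.prod_pow, ← Finset.prod_mul_distrib]
  refine Finset.prod_congr rfl fun j _ => ?_
  rw [ycoord, mul_zpow, mul_pow, mul_comm 2, zpow_mul (coord j)]
  norm_cast

variable [Finite ι] [P.IsRootSystem] (hsl : b.cartanMatrix.IsSimplyLaced)

include hsl in
lemma sigmaSub_ycoord (i j : b.support) :
    sigmaSub (Adjacent b) hq i (ycoord q j) = rootMon b q (P.reflectionPerm i j) := by
  have hs : (cst ((√q : ℝ) : ℂ) : RatFun b.support) ≠ 0 := cst_sqrt_ne_zero hq
  have hi := coord_ne_zero (σ := b.support) i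
  rw [rootMon_reflectionPerm b hq, rootMon_simple, ycoord, map_mul, sigmaSub, subst_coord,
    cst, AlgHom.commutes]
  by_cases hj : j = i
  · subst hj
    rw [sigmaPt, if_pos rfl, P.pairingIn_same, ← cst_sqrt_sq hq, ycoord]
    field_simp
  · rw [sigmaPt, if_neg hj]
    by_cases ha : Adjacent b i j
    · rw [if_pos ha, (pairingIn_of_adjacent b hsl ha).2, ycoord]
      simp only [neg_neg, zpow_one]
      ring
    · rw [if_neg ha, (pairingIn_of_not_adjacent b hsl (Ne.symm hj) ha).2]
      simp

include hsl in
-- Each y_j acquires the factor y_i^{-⟨α_j, α_i^∨⟩}, and these exponents add up linearly to -⟨α,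
-- α_i^∨⟩.
lemma sigmaSub_rootMon (i : b.support) (a : ι) :
    sigmaSub (Adjacent b) hq i (rootMon b q a) = rootMon b q (P.reflectionPerm i a) := by
  rw [rootMon_reflectionPerm b hq, ← sum_rootCoeff_mul_pairingIn b a i, ← Finset.sum_neg_distrib,
    rootMon, map_prod]
  rw [zpow_sum_eq_prod (ycoord_ne_zero hq _), ← Finset.prod_mul_distrib]
  refine Finset.prod_congr rfl fun j _ => ?_
  rw [map_zpow₀, sigmaSub_ycoord b hq hsl, rootMon_reflectionPerm b hq, rootMon_simple, mul_zpow,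
    ← zpow_mul]
  congr 2
  ring

include hsl in
lemma epsSub_ycoord (i j : b.support) :
    epsSub (Adjacent b) i (ycoord q j) = (-1) ^ P.pairingIn ℤ j i * ycoord q j := by
  rw [ycoord, map_mul, epsSub, subst_coord, cst, AlgHom.commutes, epsPt]
  by_cases ha : Adjacent b i j
  · rw [if_pos ha, (pairingIn_of_adjacent b hsl ha).2, zpow_neg_one, inv_neg_one]
    ring
  · rw [if_neg ha]
    by_cases hj : i = j
    · subst hj; simp
    · rw [(pairingIn_of_not_adjacent b hsl hj ha).2]
      simp

include hsl in
lemma epsSub_rootMon (q : ℝ) (i : b.support) (a : ι) :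
    epsSub (Adjacent b) i (rootMon b q a) = (-1) ^ P.pairingIn ℤ a i * rootMon b q a := by
  rw [← sum_rootCoeff_mul_pairingIn b a i, zpow_sum_eq_prod (by simp), rootMon, map_prod, ← Finset.prod_mul_distrib]
  refine Finset.prod_congr rfl fun j _ => ?_
  rw [map_zpow₀, epsSub_ycoord b hsl, mul_zpow, ← zpow_mul, mul_comm (P.pairingIn ℤ j i)]

include hsl in
-- This evenness lets Δ, and the denominators q - y^{2α}, pass through the slash operators by
-- `slash_mul_of_even`.
lemma epsSub_rootMon_sq (q : ℝ) (i : b.support) (a : ι) :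
    epsSub (Adjacent b) i (rootMon b q a ^ 2) = rootMon b q a ^ 2 := by
  rw [map_pow, epsSub_rootMon b hsl, mul_pow, ← zpow_natCast, ← zpow_mul, mul_comm _ ((2 : ℕ) : ℤ),
    zpow_mul]
  simp

end Substitutions


/-! ### The Coxeter relations for the slash operators -/

section FieldIdentities

variable {K : Type*} [Field K]

/-- The shape of the operator `f ↦ f | σ_i`, in terms of the substitutions `σ_i`, `ε_i` and the
normalised coordinate `u`. -/
def slashForm (s u : K) (σ ε : K →+* K) (f : K) : K :=
  (s - 1) * (u + 1) / (2 * u * (s - u)) * σ f + (s + 1) * (u - 1) / (2 * u * (s - u)) * σ (ε f)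

lemma slashForm_slashForm_self {s u : K} {σ ε : K →+* K} (h2 : (2 : K) ≠ 0) (hu : u ≠ 0)
    (hs : s - u ≠ 0) (σs : σ s = s) (εs : ε s = s) (σu : σ u = u⁻¹) (εu : ε u = u)
    (σσ : ∀ f, σ (σ f) = f) (εε : ∀ f, ε (ε f) = f) (εσ : ∀ f, ε (σ f) = σ (ε f)) (f : K) :
    slashForm s u σ ε (slashForm s u σ ε f) = f := by
  have h1 : s * u - 1 ≠ 0 := by
    have : σ (s - u) ≠ 0 := (map_ne_zero σ).mpr hs
    rw [map_sub, σs, σu] at this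
    intro h
    apply this
    field_simp
    rw [h, mul_zero]
  simp only [slashForm, map_add, map_mul, map_div₀, map_sub, map_one, map_ofNat, σs, εs, σu, εu,
    σσ, εσ, εε]
  generalize ε f = g
  field_simp
  ring

lemma slashForm_comm {s u v : K} {σ ε τ δ : K →+* K} (σs : σ s = s) (εs : ε s = s) (τs : τ s = s)
    (δs : δ s = s) (σv : σ v = v) (εv : ε v = v) (τu : τ u = u) (δu : δ u = u)
    (στ : ∀ f, σ (τ f) = τ (σ f)) (εδ : ∀ f, ε (δ f) = δ (ε f)) (ετ : ∀ f, ε (τ f) = τ (ε f))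
    (δσ : ∀ f, δ (σ f) = σ (δ f)) (f : K) :
    slashForm s u σ ε (slashForm s v τ δ f) = slashForm s v τ δ (slashForm s u σ ε f) := by
  simp only [slashForm, map_add, map_mul, map_div₀, map_sub, map_one, map_ofNat, σs, εs, τs, δs,
    σv, εv, τu, δu, στ, εδ, ετ, δσ]
  ring

/-- Each side expands into eight terms. Moving the sign changes inwards leaves τστ applied to f, εf,
δf and εδf, each with a coefficient that is a sum of two products. It remains to compare four
coefficients. -/
lemma slashForm_braid {s u v : K} {σ ε τ δ : K →+* K} (h2 : (2 : K) ≠ 0) (hu : u ≠ 0) (hv : v ≠ 0)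
    (hsu : s - u ≠ 0) (hsv : s - v ≠ 0)
    (σs : σ s = s) (εs : ε s = s) (τs : τ s = s) (δs : δ s = s)
    (σu : σ u = u⁻¹) (σv : σ v = u * v) (τu : τ u = u * v) (τv : τ v = v⁻¹)
    (εu : ε u = u) (εv : ε v = -v) (δu : δ u = -u) (δv : δ v = v)
    (στσ : ∀ f, σ (τ (σ f)) = τ (σ (τ f)))
    (εε : ∀ f, ε (ε f) = f) (δδ : ∀ f, δ (δ f) = f) (δε : ∀ f, δ (ε f) = ε (δ f))
    (εσ : ∀ f, ε (σ f) = σ (ε f)) (δτ : ∀ f, δ (τ f) = τ (δ f))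
    (ετ : ∀ f, ε (τ f) = τ (ε (δ f))) (δσ : ∀ f, δ (σ f) = σ (ε (δ f))) (f : K) :
    slashForm s u σ ε (slashForm s v τ δ (slashForm s u σ ε f))
      = slashForm s v τ δ (slashForm s u σ ε (slashForm s v τ δ f)) := by
  -- The remaining denominators are images of s - u and s - v under the substitutions, hence nonzero
  -- because field homomorphisms are injective.
  have huv : s - u * v ≠ 0 := by
    have : σ (s - v) ≠ 0 := (map_ne_zero σ).mpr hsv
    rwa [map_sub, σs, σv] at this
  have huv' : s + u * v ≠ 0 := by
    have : ε (s - u * v) ≠ 0 := (map_ne_zero ε).mpr huv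
    rw [map_sub, map_mul, εs, εu, εv] at this
    rwa [mul_neg, sub_neg_eq_add] at this
  have hsu' : s + u ≠ 0 := by
    have : δ (s - u) ≠ 0 := (map_ne_zero δ).mpr hsu
    rwa [map_sub, δs, δu, sub_neg_eq_add] at this
  have hsv' : s + v ≠ 0 := by
    have : ε (s - v) ≠ 0 := (map_ne_zero ε).mpr hsv
    rwa [map_sub, εs, εv, sub_neg_eq_add] at this
  have e1 : u⁻¹ * (u * v) = v := by field_simp
  have e2 : u * v * v⁻¹ = u := by field_simp
  have e3 : u⁻¹ * -(u * v) = -v := by field_simp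
  have e4 : -(u * v) * v⁻¹ = -u := by field_simp
  simp only [slashForm, map_add, map_mul, map_neg, map_div₀, map_sub, map_one, map_ofNat, σs, εs,
    τs, δs, σu, σv, τu, τv, εu, εv, δu, δv, εσ, δτ, ετ, δσ, δε, εε, δδ, στσ, e1, e2, e3, e4,
    neg_neg, sub_neg_eq_add]
  generalize τ (σ (τ f)) = f₁
  generalize τ (σ (τ (ε f))) = f₂
  generalize τ (σ (τ (δ f))) = f₃
  generalize τ (σ (τ (ε (δ f)))) = f₄
  -- The coefficient of `f₁` is symmetric in u and v. Those of `f₂` and `f₃` are exchanged by u ↔ v,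
  -- so `c` is stated for arbitrary u and v and used twice; `c'` handles `f₄`.
  have c (u v : K) (hu : u ≠ 0) (hv : v ≠ 0) (hsu : s - u ≠ 0) (hsu' : s + u ≠ 0)
      (hsv : s - v ≠ 0) (huv : s - u * v ≠ 0) (huv' : s + u * v ≠ 0) :
      (s - 1) * (u + 1) / (2 * u * (s - u)) * ((s - 1) * (u * v + 1) / (2 * (u * v) * (s - u * v))
          * ((s + 1) * (v - 1) / (2 * v * (s - v))))
        + (s + 1) * (u - 1) / (2 * u * (s - u)) *
          ((s + 1) * (-(u * v) - 1) / (2 * -(u * v) * (s + u * v))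
            * ((s - 1) * (v + 1) / (2 * v * (s - v))))
      = (s - 1) * (v + 1) / (2 * v * (s - v)) * ((s + 1) * (u * v - 1) / (2 * (u * v) * (s - u * v))
          * ((s + 1) * (-u - 1) / (2 * -u * (s + u))))
        + (s + 1) * (v - 1) / (2 * v * (s - v)) *
          ((s - 1) * (-(u * v) + 1) / (2 * -(u * v) * (s + u * v))
            * ((s - 1) * (-u + 1) / (2 * -u * (s + u)))) := by
    field_simp
    ring
  have c' : (s - 1) * (u + 1) / (2 * u * (s - u)) *
        ((s + 1) * (u * v - 1) / (2 * (u * v) * (s - u * v)) *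
          ((s - 1) * (-v + 1) / (2 * -v * (s + v))))
        + (s + 1) * (u - 1) / (2 * u * (s - u)) *
          ((s - 1) * (-(u * v) + 1) / (2 * -(u * v) * (s + u * v)) *
            ((s + 1) * (-v - 1) / (2 * -v * (s + v))))
      = (s - 1) * (v + 1) / (2 * v * (s - v)) *
          ((s + 1) * (u * v - 1) / (2 * (u * v) * (s - u * v)) *
            ((s - 1) * (-u + 1) / (2 * -u * (s + u))))
        + (s + 1) * (v - 1) / (2 * v * (s - v)) *
          ((s - 1) * (-(u * v) + 1) / (2 * -(u * v) * (s + u * v)) *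
            ((s + 1) * (-u - 1) / (2 * -u * (s + u)))) := by
    field_simp
    ring
  have c₂ := c u v hu hv hsu hsu' hsv huv huv'
  have c₃ := c v u hv hu hsv hsv' hsu (by rwa [mul_comm]) (by rwa [mul_comm])
  rw [mul_comm v u] at c₃
  linear_combination f₂ * c₂ - f₃ * c₃ + f₄ * c'

end FieldIdentities


/-! ### The two actions of the Weyl group -/

section Actions

lemma one_sub_coord_ne_zero {σ : Type*} (i : σ) : (1 - coord i : RatFun σ) ≠ 0 := by
  have h : (1 - X i : MvPolynomial σ ℂ) ≠ 0 := by
    intro h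
    have := congrArg (eval 0) h
    simp at this
  have h' : (1 - coord i : RatFun σ) = ofPoly (1 - X i) := by simp [coord, ofPoly]
  rw [h']
  exact (map_ne_zero_iff _ (IsFractionRing.injective (MvPolynomial σ ℂ) (RatFun σ))).mpr h

lemma cst_sqrt_sub_ycoord_ne_zero {σ : Type*} {q : ℝ} (hq : 0 < q) (i : σ) :
    cst ((√q : ℝ) : ℂ) - ycoord q i ≠ 0 := by
  have : cst ((√q : ℝ) : ℂ) - ycoord q i = cst (√q : ℝ) * (1 - coord i) := by
    rw [ycoord]; ring
  rw [this]
  exact mul_ne_zero (cst_sqrt_ne_zero hq) (one_sub_coord_ne_zero i)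

lemma ratFun_two_ne_zero {σ : Type*} : (2 : RatFun σ) ≠ 0 := two_ne_zero

lemma slash_eq_slashForm {σ : Type*} [Finite σ] (adj : σ → σ → Prop) {q : ℝ} (hq : 0 < q) (i : σ)
    (f : RatFun σ) : slash adj hq i f
      = slashForm (cst (√q : ℝ)) (ycoord q i) (sigmaSub adj hq i : RatFun σ →+* RatFun σ)
          (epsSub adj i : RatFun σ →+* RatFun σ) f := by
  have h1 := one_sub_coord_ne_zero i
  have h2 := cst_sqrt_sub_ycoord_ne_zero hq i
  have h3 := cst_sqrt_ne_zero (σ := σ) hq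
  have h4 := coord_ne_zero i
  rw [slash, slashForm, plusPart, minusPart, ← cst_sqrt_sq hq]
  simp only [map_div₀, map_add, map_sub, map_ofNat, RingHom.coe_coe]
  rw [ycoord] at *
  have h5 : cst ((√q : ℝ) : ℂ) - cst (√q : ℝ) * coord i = cst (√q : ℝ) * (1 - coord i) := by ring
  rw [h5]
  field_simp
  ring

lemma slash_add {σ : Type*} [Finite σ] (adj : σ → σ → Prop) {q : ℝ} (hq : 0 < q) (i : σ)
    (f g : RatFun σ) : slash adj hq i (f + g) = slash adj hq i f + slash adj hq i g := by
  simp only [slash_eq_slashForm, slashForm, map_add]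
  ring

/-- An even factor respects the decomposition: (gf)^± = g f^±. -/
lemma slash_mul_of_even {σ : Type*} [Finite σ] (adj : σ → σ → Prop) {q : ℝ} (hq : 0 < q) (i : σ)
    {g : RatFun σ} (hg : epsSub adj i g = g) (f : RatFun σ) :
    slash adj hq i (g * f) = sigmaSub adj hq i g * slash adj hq i f := by
  simp only [slash_eq_slashForm, slashForm, map_mul, RingHom.coe_coe, hg]
  ring

variable {ι V N : Type*} [AddCommGroup V] [Module ℝ V] [AddCommGroup N] [Module ℝ N]
  {P : RootPairing ι ℝ V N} [P.IsCrystallographic]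

lemma pairingIn_reflectionPerm_left (a c d : ι) :
    P.pairingIn ℤ (P.reflectionPerm a c) d
      = P.pairingIn ℤ c d - P.pairingIn ℤ c a * P.pairingIn ℤ a d := by
  apply FaithfulSMul.algebraMap_injective ℤ ℝ
  have h := congrArg (P.coroot' d) (root_reflectionPerm_int (P := P) a c)
  simp only [map_sub, map_zsmul, RootPairing.root_coroot'_eq_pairing] at h
  rw [map_sub, map_mul]
  simp only [RootPairing.algebraMap_pairingIn]
  rw [h, zsmul_eq_mul, ← P.algebraMap_pairingIn ℤ c a, eq_intCast]

variable (b : P.Base) {q : ℝ} (hq : 0 < q) [Finite ι] [P.IsRootSystem]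
  (hsl : b.cartanMatrix.IsSimplyLaced)

lemma weylGroupToPerm_congr {v w : P.weylGroup} (h : v = w) (a : ι) :
    P.weylGroupToPerm v a = P.weylGroupToPerm w a := by rw [h]

include hsl in
lemma sigmaSub_sigmaSub_self (i : b.support) (f : RatFun b.support) :
    sigmaSub (Adjacent b) hq i (sigmaSub (Adjacent b) hq i f) = f := by
  refine DFunLike.congr_fun (f := (sigmaSub (Adjacent b) hq i).comp (sigmaSub (Adjacent b) hq i))
    (g := AlgHom.id ℂ _) (ratFun_algHom_ext' hq fun k => ?_) f
  simp only [AlgHom.comp_apply, AlgHom.id_apply, ← rootMon_simple b, sigmaSub_rootMon b hq hsl,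
    P.reflectionPerm_self]

include hsl in
lemma sigmaSub_comm {i j : b.support} (hij : i ≠ j) (h : ¬ Adjacent b i j)
    (f : RatFun b.support) :
    sigmaSub (Adjacent b) hq i (sigmaSub (Adjacent b) hq j f)
      = sigmaSub (Adjacent b) hq j (sigmaSub (Adjacent b) hq i f) := by
  refine DFunLike.congr_fun (f := (sigmaSub (Adjacent b) hq i).comp (sigmaSub (Adjacent b) hq j))
    (g := (sigmaSub (Adjacent b) hq j).comp (sigmaSub (Adjacent b) hq i))
    (ratFun_algHom_ext' hq fun k => ?_) f
  have := weylGroupToPerm_congr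
    (simpleReflection_comm b (pairingIn_of_not_adjacent b hsl hij h).2) k
  simp only [map_mul, Equiv.Perm.mul_apply, weylGroupToPerm_simpleReflection] at this
  simp only [AlgHom.comp_apply, ← rootMon_simple b, sigmaSub_rootMon b hq hsl, this]

include hsl in
lemma sigmaSub_braid {i j : b.support} (h : Adjacent b i j) (f : RatFun b.support) :
    sigmaSub (Adjacent b) hq i (sigmaSub (Adjacent b) hq j (sigmaSub (Adjacent b) hq i f))
      = sigmaSub (Adjacent b) hq j (sigmaSub (Adjacent b) hq i (sigmaSub (Adjacent b) hq j f)) := by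
  refine DFunLike.congr_fun
    (f := ((sigmaSub (Adjacent b) hq i).comp (sigmaSub (Adjacent b) hq j)).comp
      (sigmaSub (Adjacent b) hq i))
    (g := ((sigmaSub (Adjacent b) hq j).comp (sigmaSub (Adjacent b) hq i)).comp
      (sigmaSub (Adjacent b) hq j))
    (ratFun_algHom_ext' hq fun k => ?_) f
  have := weylGroupToPerm_congr
    (simpleReflection_braid b (pairingIn_of_adjacent b hsl h).2 (pairingIn_of_adjacent b hsl h).1) k
  simp only [map_mul, Equiv.Perm.mul_apply, weylGroupToPerm_simpleReflection] at this
  simp only [AlgHom.comp_apply, ← rootMon_simple b, sigmaSub_rootMon b hq hsl, this]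

lemma epsSub_epsSub_self (i : b.support) (f : RatFun b.support) :
    epsSub (Adjacent b) i (epsSub (Adjacent b) i f) = f := by
  refine DFunLike.congr_fun (f := (epsSub (Adjacent b) i).comp (epsSub (Adjacent b) i))
    (g := AlgHom.id ℂ _) (ratFun_algHom_ext fun k => ?_) f
  simp only [AlgHom.comp_apply, AlgHom.id_apply, epsSub, subst_coord, epsPt]
  split_ifs with h
  · rw [map_neg, subst_coord, epsPt, if_pos h, neg_neg]
  · rw [subst_coord, epsPt, if_neg h]

lemma epsSub_comm (i j : b.support) (f : RatFun b.support) :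
    epsSub (Adjacent b) i (epsSub (Adjacent b) j f)
      = epsSub (Adjacent b) j (epsSub (Adjacent b) i f) := by
  refine DFunLike.congr_fun (f := (epsSub (Adjacent b) i).comp (epsSub (Adjacent b) j))
    (g := (epsSub (Adjacent b) j).comp (epsSub (Adjacent b) i)) (ratFun_algHom_ext fun k => ?_) f
  simp only [AlgHom.comp_apply, epsSub, subst_coord, epsPt]
  split_ifs with h h' h' <;> simp only [map_neg, subst_coord, epsPt, if_pos, if_neg, h, h',
    not_false_eq_true]

include hsl in
-- On y^{σ_j α} the sign of ε_i has exponent ⟨α, α_i^∨⟩ - ⟨α, α_j^∨⟩⟨α_j, α_i^∨⟩. So the parity of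
-- ⟨α_j, α_i^∨⟩ decides whether an extra ε_j appears when ε_i moves past σ_j.
lemma epsSub_sigmaSub (i j : b.support) (f g : RatFun b.support)
    (hfg : (Even (P.pairingIn ℤ j i) ∧ g = epsSub (Adjacent b) i f) ∨
      (Odd (P.pairingIn ℤ j i) ∧ g = epsSub (Adjacent b) i (epsSub (Adjacent b) j f))) :
    epsSub (Adjacent b) i (sigmaSub (Adjacent b) hq j f) = sigmaSub (Adjacent b) hq j g := by
  obtain ⟨h, rfl⟩ | ⟨h, rfl⟩ := hfg
  · refine DFunLike.congr_fun (f := (epsSub (Adjacent b) i).comp (sigmaSub (Adjacent b) hq j))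
      (g := (sigmaSub (Adjacent b) hq j).comp (epsSub (Adjacent b) i))
      (ratFun_algHom_ext' hq fun k => ?_) f
    simp only [AlgHom.comp_apply, ← rootMon_simple b, sigmaSub_rootMon b hq hsl,
      epsSub_rootMon b hsl, map_mul, map_zpow₀, map_neg, map_one, pairingIn_reflectionPerm_left]
    rw [sub_eq_add_neg, zpow_add₀ (by simp), (h.mul_left _).neg.neg_one_zpow, mul_one]
  · refine DFunLike.congr_fun (f := (epsSub (Adjacent b) i).comp (sigmaSub (Adjacent b) hq j))
      (g := (sigmaSub (Adjacent b) hq j).comp ((epsSub (Adjacent b) i).comp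
        (epsSub (Adjacent b) j)))
      (ratFun_algHom_ext' hq fun k => ?_) f
    simp only [AlgHom.comp_apply, ← rootMon_simple b, sigmaSub_rootMon b hq hsl,
      epsSub_rootMon b hsl, map_mul, map_zpow₀, map_neg, map_one, pairingIn_reflectionPerm_left]
    rw [sub_eq_add_neg, zpow_add₀ (by simp), ← mul_neg, mul_comm (P.pairingIn ℤ k j), zpow_mul,
      h.neg.neg_one_zpow]
    ring

include hsl in
lemma slash_slash_self (i : b.support) (f : RatFun b.support) :
    slash (Adjacent b) hq i (slash (Adjacent b) hq i f) = f := by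
  simp only [slash_eq_slashForm]
  refine slashForm_slashForm_self ratFun_two_ne_zero (ycoord_ne_zero hq i)
    (cst_sqrt_sub_ycoord_ne_zero hq i) (AlgHom.commutes _ _) (AlgHom.commutes _ _) ?_ ?_
    (sigmaSub_sigmaSub_self b hq hsl i) (epsSub_epsSub_self b i)
    (fun f => epsSub_sigmaSub b hq hsl i i f _ (Or.inl ⟨by simp, rfl⟩)) f
  · refine (sigmaSub_ycoord b hq hsl i i).trans ?_
    rw [rootMon_neg, rootMon_simple]
  · refine (epsSub_ycoord b hsl i i).trans ?_
    simp

include hsl in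
lemma slash_comm {i j : b.support} (hij : i ≠ j) (h : ¬ Adjacent b i j) (f : RatFun b.support) :
    slash (Adjacent b) hq i (slash (Adjacent b) hq j f)
      = slash (Adjacent b) hq j (slash (Adjacent b) hq i f) := by
  simp only [slash_eq_slashForm]
  obtain ⟨p1, p2⟩ := pairingIn_of_not_adjacent b hsl hij h
  refine slashForm_comm (AlgHom.commutes _ _) (AlgHom.commutes _ _) (AlgHom.commutes _ _)
    (AlgHom.commutes _ _) ?_ ?_ ?_ ?_ (sigmaSub_comm b hq hsl hij h) (epsSub_comm b i j)
    (fun f => epsSub_sigmaSub b hq hsl i j f _ (Or.inl ⟨by simp [p2], rfl⟩))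
    (fun f => epsSub_sigmaSub b hq hsl j i f _ (Or.inl ⟨by simp [p1], rfl⟩)) f
  · refine (sigmaSub_ycoord b hq hsl i j).trans ?_
    rw [reflectionPerm_of_pairingIn_eq_zero p2, rootMon_simple]
  · refine (epsSub_ycoord b hsl i j).trans ?_
    simp [p2]
  · refine (sigmaSub_ycoord b hq hsl j i).trans ?_
    rw [reflectionPerm_of_pairingIn_eq_zero p1, rootMon_simple]
  · refine (epsSub_ycoord b hsl j i).trans ?_
    simp [p1]

include hsl in
lemma slash_braid {i j : b.support} (h : Adjacent b i j) (f : RatFun b.support) :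
    slash (Adjacent b) hq i (slash (Adjacent b) hq j (slash (Adjacent b) hq i f))
      = slash (Adjacent b) hq j (slash (Adjacent b) hq i (slash (Adjacent b) hq j f)) := by
  simp only [slash_eq_slashForm]
  obtain ⟨p1, p2⟩ := pairingIn_of_adjacent b hsl h
  refine slashForm_braid ratFun_two_ne_zero (ycoord_ne_zero hq i) (ycoord_ne_zero hq j)
    (cst_sqrt_sub_ycoord_ne_zero hq i) (cst_sqrt_sub_ycoord_ne_zero hq j)
    (AlgHom.commutes _ _) (AlgHom.commutes _ _) (AlgHom.commutes _ _)
    (AlgHom.commutes _ _) ?_ ?_ ?_ ?_ ?_ ?_ ?_ ?_ (sigmaSub_braid b hq hsl h)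
    (epsSub_epsSub_self b i) (epsSub_epsSub_self b j) (epsSub_comm b j i)
    (fun f => epsSub_sigmaSub b hq hsl i i f _ (Or.inl ⟨by simp, rfl⟩))
    (fun f => epsSub_sigmaSub b hq hsl j j f _ (Or.inl ⟨by simp, rfl⟩))
    (fun f => epsSub_sigmaSub b hq hsl i j f _ (Or.inr ⟨by simp [p2], rfl⟩))
    (fun f => epsSub_sigmaSub b hq hsl j i f _
      (Or.inr ⟨by simp [p1], epsSub_comm b i j f⟩)) f
  · refine (sigmaSub_ycoord b hq hsl i i).trans ?_
    rw [rootMon_neg, rootMon_simple]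
  · refine (sigmaSub_ycoord b hq hsl i j).trans ?_
    rw [rootMon_reflectionPerm b hq, rootMon_simple, p2]
    simp [mul_comm]
  · refine (sigmaSub_ycoord b hq hsl j i).trans ?_
    rw [rootMon_reflectionPerm b hq, rootMon_simple, p1]
    simp
  · refine (sigmaSub_ycoord b hq hsl j j).trans ?_
    rw [rootMon_neg, rootMon_simple]
  · refine (epsSub_ycoord b hsl i i).trans ?_
    simp
  · refine (epsSub_ycoord b hsl i j).trans ?_
    rw [p2, zpow_neg_one, inv_neg_one, neg_one_mul]
  · refine (epsSub_ycoord b hsl j i).trans ?_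
    rw [p1, zpow_neg_one, inv_neg_one, neg_one_mul]
  · refine (epsSub_ycoord b hsl j j).trans ?_
    simp

variable [P.IsReduced]

include hsl in
-- Substitutions compose contravariantly, and slashing is a right action. Both are homomorphisms
-- into the opposite monoid, where the Coxeter relations read the same.
lemma exists_antiHom_of_coxeter_relations {M : Type*} [Monoid M] {S : b.support → M}
    (hsq : ∀ i, S i * S i = 1)
    (hcomm : ∀ i j : b.support, i ≠ j → ¬ Adjacent b i j → S i * S j = S j * S i)
    (hbraid : ∀ i j : b.support, Adjacent b i j → S i * S j * S i = S j * S i * S j) :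
    ∃ φ : P.weylGroup → M, φ 1 = 1 ∧ (∀ v w, φ (v * w) = φ w * φ v) ∧
      ∀ i, φ (simpleReflection b i) = S i := by
  obtain ⟨φ, hφ⟩ := exists_monoidHom_of_coxeter_relations (b := b) (M := Mᵐᵒᵖ)
    (S := fun i => MulOpposite.op (S i)) hsl
    (fun i => by rw [← MulOpposite.op_mul, hsq, MulOpposite.op_one])
    (fun i j hij h => by rw [← MulOpposite.op_mul, ← MulOpposite.op_mul, hcomm i j hij h])
    (fun i j h => by
      simp only [← MulOpposite.op_mul, ← mul_assoc]
      rw [hbraid i j h])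
  exact ⟨fun w => (φ w).unop, by simp, by simp, by simp [hφ]⟩

include hsl in
/-- The substitutions `σ_i` extend to an action of the Weyl group. -/
theorem exists_substitution_action :
    ∃ T : P.weylGroup → RatFun b.support →ₐ[ℂ] RatFun b.support,
      T 1 = AlgHom.id ℂ _ ∧ (∀ v w, T (v * w) = (T w).comp (T v)) ∧
        ∀ i, T (simpleReflection b i) = sigmaSub (Adjacent b) hq i := by
  refine exists_antiHom_of_coxeter_relations b hsl (fun i => AlgHom.ext fun f => ?_)
    (fun i j hij h => AlgHom.ext fun f => ?_) (fun i j h => AlgHom.ext fun f => ?_)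
  · rw [AlgHom.mul_apply, AlgHom.one_apply, sigmaSub_sigmaSub_self b hq hsl]
  · rw [AlgHom.mul_apply, AlgHom.mul_apply, sigmaSub_comm b hq hsl hij h]
  · simp only [AlgHom.mul_apply]
    exact sigmaSub_braid b hq hsl h f

include hsl in
/-- The operators `f ↦ f | σ_i` extend to a right action of the Weyl group. -/
theorem exists_slash_action :
    ∃ A : P.weylGroup → RatFun b.support → RatFun b.support,
      (∀ f, A 1 f = f) ∧ (∀ v w f, A (v * w) f = A w (A v f)) ∧
        ∀ i f, A (simpleReflection b i) f = slash (Adjacent b) hq i f := by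
  obtain ⟨A, h1, h2, h3⟩ := exists_antiHom_of_coxeter_relations (b := b)
    (M := Function.End (RatFun b.support)) (S := slash (Adjacent b) hq) hsl
    (fun i => funext (slash_slash_self b hq hsl i))
    (fun i j hij h => funext (slash_comm b hq hsl hij h))
    (fun i j h => funext (slash_braid b hq hsl h))
  exact ⟨A, fun f => congrFun h1 f, fun v w f => congrFun (h2 v w) f, fun i f => congrFun (h3 i) f⟩

end Actions


/-! ### Restriction to coordinate subspaces -/

section Restriction

variable {σ : Type*}

lemma setZero_X_of_mem {Z : Set σ} {j : σ} (h : j ∈ Z) : setZero Z (X j) = 0 := by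
  simp [setZero, h]

lemma setZero_X_of_notMem {Z : Set σ} {j : σ} (h : j ∉ Z) : setZero Z (X j) = X j := by
  simp [setZero, h]

lemma setZero_C (Z : Set σ) (c : ℂ) : setZero Z (C c) = C c := (setZero Z).commutes c

lemma eval_zero_setZero (Z : Set σ) (p : MvPolynomial σ ℂ) :
    eval 0 (setZero Z p) = eval 0 p := by
  classical
  have : (aeval (0 : σ → ℂ)).comp (setZero Z) = aeval (0 : σ → ℂ) := by
    refine MvPolynomial.algHom_ext fun j => ?_
    by_cases h : j ∈ Z <;> simp [setZero, h]
  simpa [MvPolynomial.coe_aeval_eq_eval] using DFunLike.congr_fun this p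

lemma setZero_univ (p : MvPolynomial σ ℂ) : setZero Set.univ p = C (eval 0 p) := by
  have : setZero (Set.univ : Set σ)
      = (Algebra.ofId ℂ (MvPolynomial σ ℂ)).comp (aeval (0 : σ → ℂ)) := by
    refine MvPolynomial.algHom_ext fun j => ?_
    simp [setZero]
  rw [this, AlgHom.comp_apply]
  simp [Algebra.ofId_apply]

lemma ofPoly_ne_zero {p : MvPolynomial σ ℂ} (h : p ≠ 0) : (ofPoly p : RatFun σ) ≠ 0 :=
  (map_ne_zero_iff _ (IsFractionRing.injective (MvPolynomial σ ℂ) (RatFun σ))).mpr h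

lemma ofPoly_C (c : ℂ) : (ofPoly (C c) : RatFun σ) = cst c :=
  (IsScalarTower.algebraMap_apply ℂ (MvPolynomial σ ℂ) (RatFun σ) c).symm

lemma ne_zero_of_setZero_ne_zero {Z : Set σ} {p : MvPolynomial σ ℂ} (h : setZero Z p ≠ 0) :
    p ≠ 0 := fun h0 => h (by rw [h0, map_zero])

lemma hasRestriction_ofPoly (Z : Set σ) (p : MvPolynomial σ ℂ) :
    HasRestriction Z (ofPoly p) (ofPoly (setZero Z p)) :=
  ⟨p, 1, by simp, by simp, by simp⟩

lemma HasRestriction.add {Z : Set σ} {f g f' g' : RatFun σ} (h : HasRestriction Z f g)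
    (h' : HasRestriction Z f' g') : HasRestriction Z (f + f') (g + g') := by
  obtain ⟨a, c, hc, rfl, rfl⟩ := h
  obtain ⟨a', c', hc', rfl, rfl⟩ := h'
  refine ⟨a * c' + c * a', c * c', by rw [map_mul]; exact mul_ne_zero hc hc', ?_, ?_⟩
  · rw [div_add_div _ _ (ofPoly_ne_zero (ne_zero_of_setZero_ne_zero hc))
      (ofPoly_ne_zero (ne_zero_of_setZero_ne_zero hc'))]
    simp only [map_add, map_mul]
  · rw [div_add_div _ _ (ofPoly_ne_zero hc) (ofPoly_ne_zero hc')]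
    simp only [map_add, map_mul]

lemma HasRestriction.mul {Z : Set σ} {f g f' g' : RatFun σ} (h : HasRestriction Z f g)
    (h' : HasRestriction Z f' g') : HasRestriction Z (f * f') (g * g') := by
  obtain ⟨a, c, hc, rfl, rfl⟩ := h
  obtain ⟨a', c', hc', rfl, rfl⟩ := h'
  refine ⟨a * a', c * c', by rw [map_mul]; exact mul_ne_zero hc hc', ?_, ?_⟩ <;>
  simp only [div_mul_div_comm, map_mul]

lemma HasRestriction.inv {Z : Set σ} {f g : RatFun σ} (h : HasRestriction Z f g) (hg : g ≠ 0) :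
    HasRestriction Z f⁻¹ g⁻¹ := by
  obtain ⟨a, c, hc, rfl, rfl⟩ := h
  refine ⟨c, a, fun h0 => hg (by rw [h0]; simp), ?_, ?_⟩ <;> rw [inv_div]

lemma HasRestriction.sum {Z : Set σ} {α : Type*} (s : Finset α) {f g : α → RatFun σ}
    (h : ∀ x ∈ s, HasRestriction Z (f x) (g x)) :
    HasRestriction Z (∑ x ∈ s, f x) (∑ x ∈ s, g x) := by
  classical
  induction s using Finset.induction_on with
  | empty => exact ⟨0, 1, by simp, by simp, by simp⟩
  | insert x s hx ih =>
    rw [Finset.sum_insert hx, Finset.sum_insert hx]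
    exact (h x (Finset.mem_insert_self x s)).add
      (ih fun y hy => h y (Finset.mem_insert_of_mem hy))

lemma HasRestriction.prod {Z : Set σ} {α : Type*} (s : Finset α) {f g : α → RatFun σ}
    (h : ∀ x ∈ s, HasRestriction Z (f x) (g x)) :
    HasRestriction Z (∏ x ∈ s, f x) (∏ x ∈ s, g x) := by
  classical
  induction s using Finset.induction_on with
  | empty => exact ⟨1, 1, by simp, by simp, by simp⟩
  | insert x s hx ih =>
    rw [Finset.prod_insert hx, Finset.prod_insert hx]
    exact (h x (Finset.mem_insert_self x s)).mul
      (ih fun y hy => h y (Finset.mem_insert_of_mem hy))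

lemma HasRestriction.hasValueAt {f : RatFun σ} {c : ℂ}
    (h : HasRestriction Set.univ f (cst c)) : HasValueAt f 0 c := by
  obtain ⟨a, d, hd, hf, hc⟩ := h
  rw [setZero_univ] at hd hc
  rw [setZero_univ] at hc
  have hd0 : eval 0 d ≠ 0 := fun h0 => hd (by rw [h0, C_0])
  refine ⟨a, d, hd0, hf, ?_⟩
  rw [ofPoly_C, ofPoly_C, cst, cst, cst, ← map_div₀] at hc
  exact (algebraMap ℂ (RatFun σ)).injective hc

/-- A rational function in the variables outside `Z` is its own restriction. -/
lemma HasRestriction.of_mem_adjoin {Z J : Set σ} (hJ : Disjoint J Z) {f : RatFun σ}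
    (hf : f ∈ IntermediateField.adjoin ℂ (coord '' J)) : HasRestriction Z f f := by
  have key : ∀ x ∈ Algebra.adjoin ℂ (coord '' J : Set (RatFun σ)),
      ∃ p : MvPolynomial σ ℂ, x = ofPoly p ∧ setZero Z p = p := by
    intro x hx
    induction hx using Algebra.adjoin_induction with
    | mem x hx =>
      obtain ⟨j, hj, rfl⟩ := hx
      exact ⟨X j, rfl, setZero_X_of_notMem (Set.disjoint_left.mp hJ hj)⟩
    | algebraMap c => exact ⟨C c, (ofPoly_C c).symm, setZero_C Z c⟩
    | add x y _ _ hx hy =>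
      obtain ⟨p, rfl, hp⟩ := hx
      obtain ⟨r, rfl, hr⟩ := hy
      exact ⟨p + r, by simp, by rw [map_add, hp, hr]⟩
    | mul x y _ _ hx hy =>
      obtain ⟨p, rfl, hp⟩ := hx
      obtain ⟨r, rfl, hr⟩ := hy
      exact ⟨p * r, by simp, by rw [map_mul, hp, hr]⟩
  rw [IntermediateField.mem_adjoin_iff_div] at hf
  obtain ⟨x, hx, y, hy, rfl⟩ := hf
  obtain ⟨p, rfl, hp⟩ := key x hx
  obtain ⟨r, rfl, hr⟩ := key y hy
  -- The description of the adjoined field by quotients allows the denominator 0, in which case the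
  -- quotient is 0.
  by_cases h0 : r = 0
  · exact ⟨0, 1, by simp, by simp [h0], by simp [h0]⟩
  · exact ⟨p, r, by rwa [hr], rfl, by rw [hp, hr]⟩

end Restriction

/-! ### Root monomials as polynomials, and their vanishing on coordinate subspaces. -/

section RootPolynomials

variable {ι V N : Type*} [AddCommGroup V] [Module ℝ V] [AddCommGroup N] [Module ℝ N]
  {P : RootPairing ι ℝ V N} (b : P.Base)

/-- The monomial attached to a positive root, as a polynomial. -/
def rootPoly (q : ℝ) (a : ι) : MvPolynomial b.support ℂ :=
  ∏ j, (C ((√q : ℝ) : ℂ) * X j) ^ (rootCoeff b a j).toNat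

lemma ofPoly_rootPoly (q : ℝ) {a : ι} (ha : b.IsPos a) :
    ofPoly (rootPoly b q a) = rootMon b q a := by
  rw [rootPoly, ofPoly, map_prod, rootMon]
  refine Finset.prod_congr rfl fun j _ => ?_
  have h : ((rootCoeff b a j).toNat : ℤ) = rootCoeff b a j :=
    Int.toNat_of_nonneg (rootCoeff_nonneg b ha j)
  nth_rewrite 2 [← h]
  rw [zpow_natCast, map_pow, map_mul, ycoord]
  congr 2

lemma setZero_rootPoly_of_pos {Z : Set b.support} (q : ℝ) {a : ι} {j : b.support} (hj : j ∈ Z)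
    (h : 0 < rootCoeff b a j) : setZero Z (rootPoly b q a) = 0 := by
  rw [rootPoly, map_prod]
  refine Finset.prod_eq_zero (Finset.mem_univ j) ?_
  rw [map_pow, map_mul, setZero_X_of_mem hj, mul_zero]
  exact zero_pow (by omega)

lemma setZero_rootPoly_of_zero {Z : Set b.support} (q : ℝ) {a : ι}
    (h : ∀ j ∈ Z, rootCoeff b a j = 0) : setZero Z (rootPoly b q a) = rootPoly b q a := by
  rw [rootPoly, map_prod]
  refine Finset.prod_congr rfl fun j _ => ?_
  by_cases hj : j ∈ Z
  · simp [h j hj]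
  · rw [map_pow, map_mul, setZero_X_of_notMem hj, setZero_C]

lemma eval_zero_rootPoly (q : ℝ) {a : ι} (ha : b.IsPos a) : eval 0 (rootPoly b q a) = 0 := by
  obtain ⟨j, hj⟩ := exists_rootCoeff_pos b ha
  rw [← eval_zero_setZero Set.univ, setZero_rootPoly_of_pos b q (Set.mem_univ j) hj, map_zero]

/-- The constant term c survives every restriction. -/
lemma setZero_C_sub_rootPoly_sq_ne_zero (Z : Set b.support) (q : ℝ) {a : ι} (ha : b.IsPos a)
    {c : ℂ} (hc : c ≠ 0) : setZero Z (C c - rootPoly b q a ^ 2) ≠ 0 := by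
  intro h
  have := congrArg (eval 0) h
  rw [eval_zero_setZero] at this
  rw [map_sub, map_pow, eval_C, eval_zero_rootPoly b q ha, map_zero] at this
  exact hc (by simpa using this)

lemma ofPoly_C_sub_rootPoly_sq (q : ℝ) {a : ι} (ha : b.IsPos a) (c : ℂ) :
    ofPoly (C c - rootPoly b q a ^ 2) = cst c - rootMon b q a ^ 2 := by
  rw [ofPoly, map_sub, map_pow]
  rw [← ofPoly_rootPoly b q ha]
  congr 1

lemma cst_sub_rootMon_sq_ne_zero (q : ℝ) {a : ι} (ha : b.IsPos a) {c : ℂ} (hc : c ≠ 0) :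
    cst c - rootMon b q a ^ 2 ≠ 0 := by
  rw [← ofPoly_C_sub_rootPoly_sq b q ha]
  exact ofPoly_ne_zero (ne_zero_of_setZero_ne_zero
    (setZero_C_sub_rootPoly_sq_ne_zero b ∅ q ha hc))

lemma one_sub_rootMon_sq_ne_zero (q : ℝ) {a : ι} (ha : b.IsPos a) :
    1 - rootMon b q a ^ 2 ≠ 0 := by
  simpa [cst] using cst_sub_rootMon_sq_ne_zero b q ha one_ne_zero

/-! ### Spans of monomials in a list of roots -/

/-- `m` is a product of positive powers of the monomials attached to the roots in the list. -/
inductive IsMonomialIn (q : ℝ) : List ι → RatFun b.support → Prop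
  | nil : IsMonomialIn q [] 1
  | cons (a : ι) (n : ℕ) {B : List ι} {m : RatFun b.support} (hm : IsMonomialIn q B m) :
      IsMonomialIn q (a :: B) (rootMon b q a ^ (n + 1) * m)

/-- The span of the products of positive powers of the monomials attached to the roots in `B`. -/
def monomialSpan (q : ℝ) (B : List ι) : Submodule ℂ (RatFun b.support) :=
  Submodule.span ℂ {m | IsMonomialIn b q B m}

lemma cst_mul_mem_monomialSpan {q : ℝ} {B : List ι} {g : RatFun b.support} (c : ℂ)
    (hg : g ∈ monomialSpan b q B) : cst c * g ∈ monomialSpan b q B := by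
  rw [cst, ← Algebra.smul_def]
  exact Submodule.smul_mem _ _ hg

lemma rootMon_pow_mul_mem_monomialSpan {q : ℝ} {B : List ι} {g : RatFun b.support} (a : ι) (n : ℕ)
    (hg : g ∈ monomialSpan b q B) :
    rootMon b q a ^ (n + 1) * g ∈ monomialSpan b q (a :: B) := by
  induction hg using Submodule.span_induction with
  | mem x hx => exact Submodule.subset_span (.cons a n hx)
  | zero => rw [mul_zero]; exact zero_mem _
  | add x y _ _ hx hy => rw [mul_add]; exact add_mem hx hy
  | smul c x _ hx => rw [mul_smul_comm]; exact Submodule.smul_mem _ _ hx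

/-- Every root of B occurs with a positive exponent in every monomial, so one variable of Z
occurring in one root of B kills the whole combination. -/
lemma exists_poly_of_mem_monomialSpan {q : ℝ} {B : List ι} (hB : ∀ a ∈ B, b.IsPos a)
    {g : RatFun b.support} (hg : g ∈ monomialSpan b q B) :
    ∃ p : MvPolynomial b.support ℂ, g = ofPoly p ∧
      ∀ Z : Set b.support, (∃ a ∈ B, ∃ j ∈ Z, 0 < rootCoeff b a j) → setZero Z p = 0 := by
  induction hg using Submodule.span_induction with
  | mem x hx =>
    induction hx with
    | nil => exact ⟨1, by simp, by simp⟩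
    | @cons a n B m hm ih =>
      obtain ⟨p, rfl, hp⟩ := ih fun a ha => hB a (List.mem_cons_of_mem _ ha)
      refine ⟨rootPoly b q a ^ (n + 1) * p, ?_, ?_⟩
      · rw [← ofPoly_rootPoly b q (hB a List.mem_cons_self)]
        simp only [map_mul, map_pow]
      · rintro Z ⟨a', ha', j, hj, hpos⟩
        rw [map_mul]
        rcases List.mem_cons.mp ha' with rfl | ha'
        · rw [map_pow, setZero_rootPoly_of_pos b q hj hpos]
          simp
        · rw [hp Z ⟨a', ha', j, hj, hpos⟩, mul_zero]
  | zero => exact ⟨0, by simp, by simp⟩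
  | add x y _ _ hx hy =>
    obtain ⟨p, rfl, hp⟩ := hx
    obtain ⟨r, rfl, hr⟩ := hy
    exact ⟨p + r, by simp, fun Z hZ => by rw [map_add, hp Z hZ, hr Z hZ, add_zero]⟩
  | smul c x _ hx =>
    obtain ⟨p, rfl, hp⟩ := hx
    refine ⟨C c * p, ?_, fun Z hZ => by rw [map_mul, hp Z hZ, mul_zero]⟩
    rw [Algebra.smul_def, ofPoly, ofPoly, map_mul]
    congr 1

variable [P.IsCrystallographic] {q : ℝ} (hq : 0 < q) [Finite ι] [P.IsRootSystem]
  (hsl : b.cartanMatrix.IsSimplyLaced)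

include hsl in
lemma sigmaSub_mem_monomialSpan (i : b.support) {B : List ι} {g : RatFun b.support}
    (hg : g ∈ monomialSpan b q B) :
    sigmaSub (Adjacent b) hq i g ∈ monomialSpan b q (B.map (P.reflectionPerm i)) := by
  induction hg using Submodule.span_induction with
  | mem x hx =>
    refine Submodule.subset_span ?_
    induction hx with
    | nil => rw [map_one]; exact .nil
    | cons a n _ ih =>
      rw [map_mul, map_pow, sigmaSub_rootMon b hq hsl]
      exact .cons _ n ih
  | zero => rw [map_zero]; exact zero_mem _
  | add x y _ _ hx hy => rw [map_add]; exact add_mem hx hy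
  | smul c x _ hx => 
    rw [Algebra.smul_def, map_mul, AlgHom.commutes, ← Algebra.smul_def]
    exact Submodule.smul_mem _ _ hx

include hsl in
lemma epsSub_mem_monomialSpan (i : b.support) {B : List ι} {g : RatFun b.support}
    (hg : g ∈ monomialSpan b q B) :
    epsSub (Adjacent b) i g ∈ monomialSpan b q B := by
  induction hg using Submodule.span_induction with
  | mem x hx =>
    have : epsSub (Adjacent b) i x = x ∨ epsSub (Adjacent b) i x = -x := by
      induction hx with
      | nil => exact Or.inl (map_one _)
      | @cons a n _ m _ ih =>
        have h : (epsSub (Adjacent b) i (rootMon b q a)) = rootMon b q a ∨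
            (epsSub (Adjacent b) i (rootMon b q a)) = -rootMon b q a := by
          rw [epsSub_rootMon b hsl]
          rcases Int.even_or_odd (P.pairingIn ℤ a i) with h | h
          · rw [h.neg_one_zpow, one_mul]; exact Or.inl rfl
          · rw [h.neg_one_zpow, neg_one_mul]; exact Or.inr rfl
        rw [map_mul, map_pow]
        have h' : epsSub (Adjacent b) i (rootMon b q a) ^ (n + 1) = rootMon b q a ^ (n + 1) ∨
            epsSub (Adjacent b) i (rootMon b q a) ^ (n + 1) = -rootMon b q a ^ (n + 1) := by
          rcases h with h | h <;> rw [h]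
          · exact Or.inl rfl
          · rcases Nat.even_or_odd (n + 1) with h | h
            · exact Or.inl (h.neg_pow _)
            · exact Or.inr (h.neg_pow _)
        rcases h' with h' | h' <;> rcases ih with ih | ih <;> rw [h', ih] <;> simp
    rcases this with h | h <;> rw [h]
    · exact Submodule.subset_span hx
    · exact neg_mem (Submodule.subset_span hx)
  | zero => rw [map_zero]; exact zero_mem _
  | add x y _ _ hx hy => rw [map_add]; exact add_mem hx hy
  | smul c x _ hx => 
    rw [Algebra.smul_def, map_mul, AlgHom.commutes, ← Algebra.smul_def]
    exact Submodule.smul_mem _ _ hx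

end RootPolynomials


/-! ### The terms `j(w, x) (1|w)(x)` -/

section Terms

variable {ι V N : Type*} [AddCommGroup V] [Module ℝ V] [AddCommGroup N] [Module ℝ N]
  {P : RootPairing ι ℝ V N} [P.IsCrystallographic] (b : P.Base) {q : ℝ} (hq : 0 < q)
  [Finite ι] [P.IsRootSystem] (hsl : b.cartanMatrix.IsSimplyLaced)

/-- The subgroup of the Weyl group generated by the simple reflections in `J`. -/
def parabolic (J : Set b.support) : Subgroup P.weylGroup :=
  Subgroup.closure (simpleReflection b '' J)

include hsl in
lemma sigmaSub_mem_adjoin {J : Set b.support} {i : b.support} (hi : i ∈ J) {f : RatFun b.support}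
    (hf : f ∈ IntermediateField.adjoin ℂ (coord '' J)) :
    sigmaSub (Adjacent b) hq i f ∈ IntermediateField.adjoin ℂ (coord '' J) := by
  have hc : ∀ j ∈ J, (coord j : RatFun b.support) ∈ IntermediateField.adjoin ℂ (coord '' J) :=
    fun j hj => IntermediateField.subset_adjoin ℂ _ ⟨j, hj, rfl⟩
  have hcst : ∀ c : ℂ, (cst c : RatFun b.support) ∈ IntermediateField.adjoin ℂ (coord '' J) :=
    fun c => IntermediateField.algebraMap_mem _ c
  have hle : IntermediateField.adjoin ℂ (coord '' J)
      ≤ (IntermediateField.adjoin ℂ (coord '' J)).comap (sigmaSub (Adjacent b) hq i) := by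
    rw [IntermediateField.adjoin_le_iff]
    rintro _ ⟨j, hj, rfl⟩
    change sigmaSub (Adjacent b) hq i (coord j) ∈ IntermediateField.adjoin ℂ (coord '' J)
    rw [sigmaSub, subst_coord, sigmaPt]
    split_ifs
    · exact div_mem (one_mem _) (mul_mem (hcst _) (hc i hi))
    · exact mul_mem (mul_mem (hc i hi) (hc j hj)) (hcst _)
    · exact hc j hj
  exact hle hf

lemma epsSub_mem_adjoin {J : Set b.support} {i : b.support} {f : RatFun b.support}
    (hf : f ∈ IntermediateField.adjoin ℂ (coord '' J)) :
    epsSub (Adjacent b) i f ∈ IntermediateField.adjoin ℂ (coord '' J) := by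
  have hc : ∀ j ∈ J, (coord j : RatFun b.support) ∈ IntermediateField.adjoin ℂ (coord '' J) :=
    fun j hj => IntermediateField.subset_adjoin ℂ _ ⟨j, hj, rfl⟩
  have hle : IntermediateField.adjoin ℂ (coord '' J)
      ≤ (IntermediateField.adjoin ℂ (coord '' J)).comap (epsSub (Adjacent b) i) := by
    rw [IntermediateField.adjoin_le_iff]
    rintro _ ⟨j, hj, rfl⟩
    change epsSub (Adjacent b) i (coord j) ∈ IntermediateField.adjoin ℂ (coord '' J)
    rw [epsSub, subst_coord, epsPt]
    split_ifs
    · exact neg_mem (hc j hj)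
    · exact hc j hj
  exact hle hf

lemma sigmaSub_of_mem_adjoin {J : Set b.support} {i : b.support} (hi : i ∉ J)
    (hadj : ∀ j ∈ J, ¬ Adjacent b i j) {f : RatFun b.support}
    (hf : f ∈ IntermediateField.adjoin ℂ (coord '' J)) : sigmaSub (Adjacent b) hq i f = f := by
  induction hf using IntermediateField.adjoin_induction with
  | mem x hx =>
    obtain ⟨j, hj, rfl⟩ := hx
    rw [sigmaSub, subst_coord, sigmaPt, if_neg (fun e : j = i => hi (e ▸ hj)), if_neg (hadj j hj)]
  | algebraMap c => exact AlgHom.commutes _ _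
  | add x y _ _ hx hy => rw [map_add, hx, hy]
  | mul x y _ _ hx hy => rw [map_mul, hx, hy]
  | inv x _ hx => rw [map_inv₀, hx]

lemma epsSub_of_mem_adjoin {J : Set b.support} {i : b.support}
    (hadj : ∀ j ∈ J, ¬ Adjacent b i j) {f : RatFun b.support}
    (hf : f ∈ IntermediateField.adjoin ℂ (coord '' J)) : epsSub (Adjacent b) i f = f := by
  induction hf using IntermediateField.adjoin_induction with
  | mem x hx =>
    obtain ⟨j, hj, rfl⟩ := hx
    rw [epsSub, subst_coord, epsPt, if_neg (hadj j hj)]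
  | algebraMap c => exact AlgHom.commutes _ _
  | add x y _ _ hx hy => rw [map_add, hx, hy]
  | mul x y _ _ hx hy => rw [map_mul, hx, hy]
  | inv x _ hx => rw [map_inv₀, hx]

variable {h : P.weylGroup → RatFun b.support} (h1 : h 1 = 1)
  (hmul : ∀ v i, h (v * simpleReflection b i)
    = -ycoord q i ^ 2 * slash (Adjacent b) hq i (h v))

include hsl h1 hmul in
-- The family `h` models the terms j(w, x) (1|w), of which only `h1` and the recursion `hmul` are
-- used; `term_mul_simpleReflection` supplies the latter. One step of the recursion with i ∈ J
-- introduces no variable outside J.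
lemma term_mem_adjoin {J : Set b.support} {w : P.weylGroup} (hw : w ∈ parabolic b J) :
    h w ∈ IntermediateField.adjoin ℂ (coord '' J) := by
  have step : ∀ v, ∀ i ∈ J, h v ∈ IntermediateField.adjoin ℂ (coord '' J) →
      h (v * simpleReflection b i) ∈ IntermediateField.adjoin ℂ (coord '' J) := by
    intro v i hi hv
    have hc : (coord i : RatFun b.support) ∈ IntermediateField.adjoin ℂ (coord '' J) :=
      IntermediateField.subset_adjoin ℂ _ ⟨i, hi, rfl⟩
    have hcst : ∀ c : ℂ, (cst c : RatFun b.support) ∈ IntermediateField.adjoin ℂ (coord '' J) :=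
      fun c => IntermediateField.algebraMap_mem _ c
    have h2 : (2 : RatFun b.support) ∈ IntermediateField.adjoin ℂ (coord '' J) :=
      ofNat_mem _ 2
    have hσ := fun {f} (hf : f ∈ IntermediateField.adjoin ℂ (coord '' J)) =>
      sigmaSub_mem_adjoin b hq hsl hi hf
    have hε := fun {f} (hf : f ∈ IntermediateField.adjoin ℂ (coord '' J)) =>
      epsSub_mem_adjoin b (i := i) hf
    rw [hmul, slash, plusPart, minusPart, ycoord]
    refine mul_mem (neg_mem (pow_mem (mul_mem (hcst _) hc) 2)) (add_mem (mul_mem (neg_mem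
      (div_mem (sub_mem (one_mem _) (mul_mem (hcst _) hc)) (mul_mem (mul_mem (hcst _) hc)
        (sub_mem (one_mem _) hc)))) ?_) (mul_mem (div_mem (one_mem _) (mul_mem hc (hcst _))) ?_))
    · exact hσ (div_mem (add_mem hv (hε hv)) h2)
    · exact hσ (div_mem (sub_mem hv (hε hv)) h2)
  induction hw using Subgroup.closure_induction_right with
  | one => rw [h1]; exact one_mem _
  | mul_right x _ y hy hx =>
    obtain ⟨i, hi, rfl⟩ := hy
    exact step x i hi hx
  | mul_inv_cancel x _ y hy hx =>
    obtain ⟨i, hi, rfl⟩ := hy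
    rw [simpleReflection_inv]
    exact step x i hi hx

include hsl hmul in
-- No variable of h(u) is moved by σ_i or ε_i, so the odd part vanishes and h(uσ_i) = x_i(1 - q
-- x_i)/(1 - x_i) · h(u). Adding h(u) leaves the numerator 1 - q x_i².
lemma term_add_term {J : Set b.support} {i : b.support} (hi : i ∉ J)
    (hadj : ∀ j ∈ J, ¬ Adjacent b i j) {u : P.weylGroup}
    (hu : h u ∈ IntermediateField.adjoin ℂ (coord '' J)) :
    h u + h (u * simpleReflection b i)
      = (1 - rootMon b q i ^ 2) / (1 - coord i) * h u := by
  have hd := one_sub_coord_ne_zero i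
  have hs := cst_sqrt_ne_zero (σ := b.support) hq
  have hc := coord_ne_zero i
  have hε := epsSub_of_mem_adjoin b hadj hu
  have hσ := sigmaSub_of_mem_adjoin b hq hi hadj hu
  rw [hmul, slash, plusPart, minusPart, hε, sub_self, zero_div, map_zero, mul_zero, add_zero,
    add_self_div_two, hσ, rootMon_simple, ycoord, ← cst_sqrt_sq hq]
  field_simp
  ring

include hsl h1 hmul in
/-- Each term is a polynomial combination of monomials over its inversion set. -/
lemma exists_inversion_list [P.IsReduced] (w : P.weylGroup) : ∃ B : List ι,
    (∀ a ∈ B, b.IsPos a ∧ ¬ b.IsPos (P.weylGroupToPerm w a)) ∧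
    (∀ J : Set b.support, (∀ a ∈ B, ∀ j ∉ J, rootCoeff b a j = 0) → w ∈ parabolic b J) ∧
    h w * (B.map fun a => cst q - rootMon b q a ^ 2).prod ∈ monomialSpan b q B := by
  classical
  refine weylGroup_induction b (p := fun w => ∃ B : List ι,
    (∀ a ∈ B, b.IsPos a ∧ ¬ b.IsPos (P.weylGroupToPerm w a)) ∧
    (∀ J : Set b.support, (∀ a ∈ B, ∀ j ∉ J, rootCoeff b a j = 0) → w ∈ parabolic b J) ∧
    h w * (B.map fun a => cst q - rootMon b q a ^ 2).prod ∈ monomialSpan b q B) ?_ ?_ w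
  · refine ⟨[], by simp, fun J _ => one_mem _, ?_⟩
    rw [h1, List.map_nil, List.prod_nil, mul_one]
    exact Submodule.subset_span .nil
  · rintro v i hi ⟨B, hB, hJ, hN⟩
    -- The inversions of vσ_i, when vα_i > 0, are α_i and the images under σ_i of the inversions of
    -- v.
    refine ⟨i :: B.map (P.reflectionPerm i), ?_, ?_, ?_⟩
    · intro a ha
      rcases List.mem_cons.mp ha with rfl | ha
      · refine ⟨RootPairing.Base.isPos_of_mem_support i.2, ?_⟩
        rwa [isPos_mul_simpleReflection_iff, not_not]
      · obtain ⟨c, hc, rfl⟩ := List.mem_map.mp ha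
        obtain ⟨ha1, ha2⟩ := hB c hc
        refine ⟨ha1.reflectionPerm i.2 ?_, ?_⟩
        · rintro rfl
          exact ha2 hi
        · rwa [map_mul, Equiv.Perm.mul_apply, weylGroupToPerm_simpleReflection,
            P.reflectionPerm_self]
    · intro J hJ'
      have hiJ : i ∈ J := by
        by_contra hiJ
        have := hJ' i List.mem_cons_self i hiJ
        rw [rootCoeff_simple] at this
        simp at this
      refine mul_mem (hJ J fun a ha j hj => ?_) (Subgroup.subset_closure ⟨i, hiJ, rfl⟩)
      -- Since i ∈ J, applying σ_i changes no coefficient outside J.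
      have := hJ' _ (List.mem_cons_of_mem _ (List.mem_map_of_mem ha)) j hj
      rw [rootCoeff_reflectionPerm] at this
      have hne : j ≠ i := fun h => hj (h ▸ hiJ)
      simpa [hne] using this
    · set D := (B.map fun a => cst q - rootMon b q a ^ 2).prod with hD
      set y := rootMon b q i with hy
      have hyc : ycoord q i = y := (rootMon_simple b q i).symm
      set s : RatFun b.support := cst ((√q : ℝ) : ℂ) with hs
      have hεD : epsSub (Adjacent b) i D = D := by
        rw [hD, map_list_prod, List.map_map]
        congr 1
        refine List.map_congr_left fun a _ => ?_
        rw [Function.comp_apply, map_sub, epsSub_rootMon_sq b hsl, cst, AlgHom.commutes]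
      have hσD : sigmaSub (Adjacent b) hq i D
          = ((B.map (P.reflectionPerm i)).map fun a => cst q - rootMon b q a ^ 2).prod := by
        rw [hD, map_list_prod, List.map_map, List.map_map]
        congr 1
        refine List.map_congr_left fun a _ => ?_
        rw [Function.comp_apply, Function.comp_apply, map_sub, map_pow,
          sigmaSub_rootMon b hq hsl, cst, AlgHom.commutes]
      have hNσ := sigmaSub_mem_monomialSpan b hq hsl i hN
      have hNε := sigmaSub_mem_monomialSpan b hq hsl i (epsSub_mem_monomialSpan b hsl i hN)
      have hsl' := slash_mul_of_even (Adjacent b) hq i hεD (h v)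
      rw [mul_comm D] at hsl'
      have hy0 : y ≠ 0 := rootMon_ne_zero b hq i
      have hsy : s - y ≠ 0 := by rw [← hyc]; exact cst_sqrt_sub_ycoord_ne_zero hq i
      set g₁ := sigmaSub (Adjacent b) hq i (h v * D) with hg₁
      set g₂ := sigmaSub (Adjacent b) hq i (epsSub (Adjacent b) i (h v * D)) with hg₂
      have e : slash (Adjacent b) hq i (h v * D)
          = (s - 1) * (y + 1) / (2 * y * (s - y)) * g₁
            + (s + 1) * (y - 1) / (2 * y * (s - y)) * g₂ := by
        rw [slash_eq_slashForm, slashForm, hyc]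
        rfl
      rw [List.map_cons, List.prod_cons, ← hσD, hmul, hyc]
      -- The old denominator is even and passes through the slash operator. The new factor q - y² =
      -- (s - y)(s + y) will cancel the pole s - y of that operator.
      have e2 : -y ^ 2 * slash (Adjacent b) hq i (h v)
            * ((cst q - y ^ 2) * sigmaSub (Adjacent b) hq i D)
          = -y ^ 2 * (s ^ 2 - y ^ 2) * slash (Adjacent b) hq i (h v * D) := by
        rw [hsl', hs, cst_sqrt_sq hq]
        ring
      have c₁ : ∀ c : ℂ, ∀ n : ℕ, cst c * (y ^ (n + 1) * g₁)
          ∈ monomialSpan b q (i :: B.map (P.reflectionPerm i)) := fun c n =>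
        cst_mul_mem_monomialSpan b c (rootMon_pow_mul_mem_monomialSpan b (i : ι) n hNσ)
      have c₂ : ∀ c : ℂ, ∀ n : ℕ, cst c * (y ^ (n + 1) * g₂)
          ∈ monomialSpan b q (i :: B.map (P.reflectionPerm i)) := fun c n =>
        cst_mul_mem_monomialSpan b c (rootMon_pow_mul_mem_monomialSpan b (i : ι) n hNε)
      let z : ℂ := (√q : ℝ)
      -- After cancellation the coefficients are -(s-1)/2 · y(y+1)(s+y) for `g₁` and -(s+1)/2 ·
      -- y(y-1)(s+y) for `g₂`. Both expand in y, y², y³, so y always has a positive exponent.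
      have e3 : -y ^ 2 * slash (Adjacent b) hq i (h v)
            * ((cst q - y ^ 2) * sigmaSub (Adjacent b) hq i D)
          = (cst (-(z - 1) * z / 2) * (y ^ (0 + 1) * g₁)
            + cst (-(z - 1) * (z + 1) / 2) * (y ^ (1 + 1) * g₁)
            + cst (-(z - 1) / 2) * (y ^ (2 + 1) * g₁))
            + (cst ((z + 1) * z / 2) * (y ^ (0 + 1) * g₂)
            + cst (-(z + 1) * (z - 1) / 2) * (y ^ (1 + 1) * g₂)
            + cst (-(z + 1) / 2) * (y ^ (2 + 1) * g₂)) := by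
        have hz : algebraMap ℂ (RatFun b.support) z = s := rfl
        rw [e2, e]
        simp only [cst, map_div₀, map_mul, map_neg, map_sub, map_add, map_one, map_ofNat, hz]
        have : s ^ 2 - y ^ 2 = (s - y) * (s + y) := by ring
        rw [this]
        field_simp
        ring
      rw [e3]
      exact add_mem (add_mem (add_mem (c₁ _ _) (c₁ _ _)) (c₁ _ _))
        (add_mem (add_mem (c₂ _ _) (c₂ _ _)) (c₂ _ _))

include hsl h1 hmul in
-- As w is outside the parabolic subgroup, some listed inversion involves a variable of Z and the
-- numerator restricts to 0. The denominator does not, its constant term being a power of q.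
lemma hasRestriction_term_zero [P.IsReduced] {Z : Set b.support} {w : P.weylGroup}
    (hw : w ∉ parabolic b Zᶜ) : HasRestriction Z (h w) 0 := by
  obtain ⟨B, hB, hJ, hN⟩ := exists_inversion_list b hq hsl h1 hmul w
  obtain ⟨p, hp, hpZ⟩ := exists_poly_of_mem_monomialSpan b (fun a ha => (hB a ha).1) hN
  have hqC : (q : ℂ) ≠ 0 := by exact_mod_cast hq.ne'
  have hex : ∃ a ∈ B, ∃ j ∈ Z, 0 < rootCoeff b a j := by
    by_contra! hcon
    refine hw (hJ Zᶜ fun a ha j hj => le_antisymm (hcon a ha j (not_not.mp hj)) ?_)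
    exact rootCoeff_nonneg b (hB a ha).1 j
  have hD : ofPoly (B.map fun a => C (q : ℂ) - rootPoly b q a ^ 2).prod
      = (B.map fun a => cst q - rootMon b q a ^ 2).prod := by
    rw [ofPoly, map_list_prod, List.map_map]
    congr 1
    exact List.map_congr_left fun a ha => ofPoly_C_sub_rootPoly_sq b q (hB a ha).1 _
  have hDZ : setZero Z (B.map fun a => C (q : ℂ) - rootPoly b q a ^ 2).prod ≠ 0 := by
    rw [map_list_prod, List.map_map, Ne, List.prod_eq_zero_iff]
    intro h0
    obtain ⟨a, ha, h0⟩ := List.mem_map.mp h0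
    exact setZero_C_sub_rootPoly_sq_ne_zero b Z q (hB a ha).1 hqC h0
  refine ⟨p, _, hDZ, ?_, ?_⟩
  · rw [eq_div_iff (ofPoly_ne_zero (ne_zero_of_setZero_ne_zero hDZ)), hD, hp]
  · rw [hpZ Z hex, ofPoly, map_zero, zero_div]

end Terms


/-! ### The average over the Weyl group. -/

section Average

variable {ι V N : Type*} [AddCommGroup V] [Module ℝ V] [AddCommGroup N] [Module ℝ N]
  {P : RootPairing ι ℝ V N} [P.IsCrystallographic] (b : P.Base) {q : ℝ} (hq : 0 < q)
  [Fintype ι] [P.IsRootSystem] (hsl : b.cartanMatrix.IsSimplyLaced)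

include hq in
lemma bigDelta_ne_zero : (bigDelta b q : RatFun b.support) ≠ 0 := by
  classical
  rw [bigDelta_eq b hq]
  exact Finset.prod_ne_zero_iff.mpr fun a ha =>
    one_sub_rootMon_sq_ne_zero b q (Finset.mem_filter.mp ha).2

include hsl in
-- σ_i permutes the positive roots other than α_i, and the remaining factor satisfies 1 - y² = -y²(1
-- - y⁻²).
lemma bigDelta_eq_mul_sigmaSub [P.IsReduced] (i : b.support) :
    bigDelta b q = -ycoord q i ^ 2 * sigmaSub (Adjacent b) hq i (bigDelta b q) := by
  classical
  have hi : (i : ι) ∈ Finset.univ.filter fun a => b.IsPos a :=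
    Finset.mem_filter.mpr ⟨Finset.mem_univ _, RootPairing.Base.isPos_of_mem_support i.2⟩
  have hy := ycoord_ne_zero (σ := b.support) hq i
  rw [bigDelta_eq b hq, map_prod, ← Finset.mul_prod_erase _ _ hi, ← Finset.mul_prod_erase _ _ hi]
  have e : ∏ a ∈ (Finset.univ.filter fun a => b.IsPos a).erase (i : ι), (1 - rootMon b q a ^ 2)
      = ∏ a ∈ (Finset.univ.filter fun a => b.IsPos a).erase (i : ι),
        sigmaSub (Adjacent b) hq i (1 - rootMon b q a ^ 2) := by
    have hmaps : ∀ a ∈ (Finset.univ.filter fun a => b.IsPos a).erase (i : ι),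
        P.reflectionPerm i a ∈ (Finset.univ.filter fun a => b.IsPos a).erase (i : ι) := by
      intro a ha
      simp only [Finset.mem_erase, Finset.mem_filter, Finset.mem_univ, true_and] at ha ⊢
      refine ⟨fun h => ?_, ha.2.reflectionPerm i.2 ha.1⟩
      have h' : a = P.reflectionPerm i i := by
        have := congrArg (P.reflectionPerm i) h
        rwa [P.reflectionPerm_self] at this
      rw [h', isPos_neg_iff] at ha
      exact ha.2 (RootPairing.Base.isPos_of_mem_support i.2)
    refine Finset.prod_bij' (fun a _ => P.reflectionPerm i a) (fun a _ => P.reflectionPerm i a)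
      hmaps hmaps (fun a _ => P.reflectionPerm_self _ _) (fun a _ => P.reflectionPerm_self _ _) ?_
    intro a _
    rw [map_sub, map_one, map_pow, sigmaSub_rootMon b hq hsl, P.reflectionPerm_self]
  rw [← e, ← mul_assoc]
  congr 1
  rw [map_sub, map_one, map_pow, sigmaSub_rootMon b hq hsl, rootMon_neg, rootMon_simple]
  field_simp
  ring

/-! ### Invariance of the average and the recursion for its terms. -/

section ActionConsequences

variable {T : P.weylGroup → RatFun b.support →ₐ[ℂ] RatFun b.support}
  (hT1 : T 1 = AlgHom.id ℂ _) (hTm : ∀ v w, T (v * w) = (T w).comp (T v))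
  (hTs : ∀ i, T (simpleReflection b i) = sigmaSub (Adjacent b) hq i)
  {A : P.weylGroup → RatFun b.support → RatFun b.support}
  (hA1 : ∀ f, A 1 f = f) (hAm : ∀ v w f, A (v * w) f = A w (A v f))
  (hAs : ∀ i f, A (simpleReflection b i) f = slash (Adjacent b) hq i f)

variable [P.IsReduced]

include hsl hT1 hTm hTs in
lemma exists_perm_rootMon (w : P.weylGroup) :
    ∃ e : ι ≃ ι, ∀ a, T w (rootMon b q a) = rootMon b q (e a) := by
  refine weylGroup_induction b
    (p := fun w => ∃ e : ι ≃ ι, ∀ a, T w (rootMon b q a) = rootMon b q (e a))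
    ⟨Equiv.refl _, fun a => by rw [hT1]; rfl⟩ ?_ w
  rintro v i _ ⟨e, he⟩
  refine ⟨e.trans (P.reflectionPerm i), fun a => ?_⟩
  rw [hTm, AlgHom.comp_apply, he, hTs, sigmaSub_rootMon b hq hsl]
  rfl

include hsl hT1 hTm hTs in
lemma epsSub_T_bigDelta (w : P.weylGroup) (i : b.support) :
    epsSub (Adjacent b) i (T w (bigDelta b q)) = T w (bigDelta b q) := by
  obtain ⟨e, he⟩ := exists_perm_rootMon b hq hsl hT1 hTm hTs w
  rw [bigDelta_eq b hq]
  simp only [map_prod]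
  refine Finset.prod_congr rfl fun a _ => ?_
  rw [map_sub, map_sub, map_one, map_one, map_pow, he, epsSub_rootMon_sq b hsl]

include hsl hT1 hTm hTs hA1 hAm hAs in
-- T_v Δ is a product of factors 1 - y^{2α}, hence even for every ε_i, and factors out of each
-- successive slash operator.
lemma A_inv_bigDelta_mul (w : P.weylGroup) (f : RatFun b.support) :
    A w ((bigDelta b q)⁻¹ * f) = (T w (bigDelta b q))⁻¹ * A w f := by
  refine weylGroup_induction b
    (p := fun w => A w ((bigDelta b q)⁻¹ * f) = (T w (bigDelta b q))⁻¹ * A w f) ?_ ?_ w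
  · rw [hA1, hA1, hT1]; rfl
  · intro v i _ ih
    rw [hAm, ih, hAs, slash_mul_of_even, hAm, hAs, hTm, AlgHom.comp_apply, hTs, map_inv₀]
    rw [map_inv₀, epsSub_T_bigDelta b hq hsl hT1 hTm hTs]

include hA1 hAm hAs in
lemma A_sum {α : Type*} (s : Finset α) (f : α → RatFun b.support) (w : P.weylGroup) :
    A w (∑ x ∈ s, f x) = ∑ x ∈ s, A w (f x) := by
  have hadd : ∀ f g, A w (f + g) = A w f + A w g := by
    refine weylGroup_induction b (p := fun w => ∀ f g, A w (f + g) = A w f + A w g) ?_ ?_ w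
    · intro f g; rw [hA1, hA1, hA1]
    · intro v i _ ih f g
      rw [hAm, ih, hAs, slash_add, hAm, hAs, hAm, hAs]
  exact map_sum (AddMonoidHom.mk' (A w) hadd) f s

include hsl hT1 hTm hTs hA1 hAm hAs in
lemma average_eq [Fintype P.weylGroup] : (bigDelta b q)⁻¹ *
      ∑ w : P.weylGroup, bigDelta b q / T w (bigDelta b q) * A w 1
    = ∑ w : P.weylGroup, A w (bigDelta b q)⁻¹ := by
  rw [Finset.mul_sum]
  refine Finset.sum_congr rfl fun w _ => ?_
  have := A_inv_bigDelta_mul b hq hsl hT1 hTm hTs hA1 hAm hAs w 1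
  rw [mul_one] at this
  rw [this]
  have := bigDelta_ne_zero b hq
  field_simp

include hsl hT1 hTm hTs hA1 hAm hAs in
lemma average_invariant [Fintype P.weylGroup] (v : P.weylGroup) : A v ((bigDelta b q)⁻¹ *
      ∑ w : P.weylGroup, bigDelta b q / T w (bigDelta b q) * A w 1)
    = (bigDelta b q)⁻¹ * ∑ w : P.weylGroup, bigDelta b q / T w (bigDelta b q) * A w 1 := by
  rw [average_eq b hq hsl hT1 hTm hTs hA1 hAm hAs, A_sum b hq hA1 hAm hAs]
  simp only [← hAm]
  exact Fintype.sum_equiv (Equiv.mulRight v) _ _ fun w => rfl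

include hsl hT1 hTm hTs hAm hAs in
lemma term_mul_simpleReflection (v : P.weylGroup) (i : b.support) :
    bigDelta b q / T (v * simpleReflection b i) (bigDelta b q) * A (v * simpleReflection b i) 1
      = -ycoord q i ^ 2 *
        slash (Adjacent b) hq i (bigDelta b q / T v (bigDelta b q) * A v 1) := by
  have hε : epsSub (Adjacent b) i (bigDelta b q / T v (bigDelta b q))
      = bigDelta b q / T v (bigDelta b q) := by
    have h1 := epsSub_T_bigDelta b hq hsl hT1 hTm hTs 1 i
    rw [hT1, AlgHom.id_apply] at h1
    rw [map_div₀, epsSub_T_bigDelta b hq hsl hT1 hTm hTs, h1]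
  rw [slash_mul_of_even _ _ _ hε, hAm, hAs, hTm, AlgHom.comp_apply, hTs, map_div₀]
  nth_rewrite 1 [bigDelta_eq_mul_sigmaSub b hq hsl i]
  ring

end ActionConsequences

/-! ### Restriction of the average to coordinate subspaces. -/

variable {h : P.weylGroup → RatFun b.support} (h1 : h 1 = 1)
  (hmul : ∀ v i, h (v * simpleReflection b i)
    = -ycoord q i ^ 2 * slash (Adjacent b) hq i (h v))
  [P.IsReduced]

open Classical in
/-- The restriction of `Δ` to the subspace `x_j = 0`, `j ∈ Z`. -/
def restrictedDelta (q : ℝ) (Z : Set b.support) : RatFun b.support :=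
  ∏ a : ι with b.IsPos a, if ∀ j ∈ Z, rootCoeff b a j = 0 then 1 - rootMon b q a ^ 2 else 1

include hq in
lemma hasRestriction_bigDelta (Z : Set b.support) :
    HasRestriction Z (bigDelta b q) (restrictedDelta b q Z) := by
  classical
  rw [bigDelta_eq b hq, restrictedDelta]
  refine HasRestriction.prod _ fun a ha => ?_
  have ha : b.IsPos a := (Finset.mem_filter.mp ha).2
  have e : ofPoly (C 1 - rootPoly b q a ^ 2) = 1 - rootMon b q a ^ 2 := by
    rw [ofPoly_C_sub_rootPoly_sq b q ha, cst, map_one]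
  have hr := hasRestriction_ofPoly Z (C 1 - rootPoly b q a ^ 2)
  rw [e, map_sub, map_pow, setZero_C] at hr
  split_ifs with hZ
  · rwa [setZero_rootPoly_of_zero b q hZ, e] at hr
  · push Not at hZ
    obtain ⟨j, hj, hne⟩ := hZ
    have hpos := lt_of_le_of_ne (rootCoeff_nonneg b ha j) (Ne.symm hne)
    rw [setZero_rootPoly_of_pos b q hj hpos] at hr
    simpa [ofPoly] using hr

lemma restrictedDelta_ne_zero (Z : Set b.support) : restrictedDelta b q Z ≠ 0 := by
  classical
  refine Finset.prod_ne_zero_iff.mpr fun a ha => ?_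
  split_ifs
  · exact one_sub_rootMon_sq_ne_zero b q (Finset.mem_filter.mp ha).2
  · exact one_ne_zero

include hsl h1 hmul in
open Classical in
-- Terms outside the parabolic subgroup restrict to 0. Those inside do not contain the variables of
-- Z, so they are their own restriction.
lemma hasRestriction_average [Fintype P.weylGroup] (Z : Set b.support) :
    HasRestriction Z ((bigDelta b q)⁻¹ * ∑ w, h w)
      ((restrictedDelta b q Z)⁻¹ * ∑ w : P.weylGroup with w ∈ parabolic b Zᶜ, h w) := by
  refine ((hasRestriction_bigDelta b hq Z).inv (restrictedDelta_ne_zero b Z)).mul ?_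
  rw [Finset.sum_filter]
  refine HasRestriction.sum _ fun w _ => ?_
  split_ifs with hw
  · exact HasRestriction.of_mem_adjoin disjoint_compl_left
      (term_mem_adjoin b hq hsl h1 hmul hw)
  · exact hasRestriction_term_zero b hq hsl h1 hmul hw

include hsl h1 hmul in
lemma hasValueAt_average [Fintype P.weylGroup] :
    HasValueAt ((bigDelta b q)⁻¹ * ∑ w, h w) 0 1 := by
  classical
  apply HasRestriction.hasValueAt
  have hr := hasRestriction_average b hq hsl h1 hmul Set.univ
  have hd : restrictedDelta b q Set.univ = 1 := by
    refine Finset.prod_eq_one fun a ha => if_neg fun hz => ?_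
    obtain ⟨j, hj⟩ := exists_rootCoeff_pos b (Finset.mem_filter.mp ha).2
    exact hj.ne' (hz j trivial)
  have hs : (∑ w : P.weylGroup with w ∈ parabolic b Set.univᶜ, h w) = 1 := by
    have hf : (Finset.univ.filter fun w => w ∈ parabolic b Set.univᶜ) = {1} := by
      ext w
      simp [parabolic]
    rw [hf, Finset.sum_singleton, h1]
  rw [hd, hs] at hr
  simpa [cst] using hr

include hsl in
-- Without neighbours of i in its support, α has ⟨α, α_i^∨⟩ = 2k_i. The root σ_i α is then still
-- positive with coefficient -k_i at α_i, which forces k_i = 0.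
lemma rootCoeff_eq_zero_of_adjacent {a : ι} {i : b.support} (ha : b.IsPos a) (hai : a ≠ i)
    (hz : ∀ j, Adjacent b i j → rootCoeff b a j = 0) : rootCoeff b a i = 0 := by
  classical
  have hp : P.pairingIn ℤ a i = 2 * rootCoeff b a i := by
    rw [← sum_rootCoeff_mul_pairingIn b, Finset.sum_eq_single i]
    · rw [P.pairingIn_same, mul_comm]
    · intro j _ hj
      by_cases hadj : Adjacent b i j
      · rw [hz j hadj, zero_mul]
      · rw [(pairingIn_of_not_adjacent b hsl hj.symm hadj).2, mul_zero]
    · simp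
  have h1 := rootCoeff_nonneg b ha i
  have h2 := rootCoeff_nonneg b (ha.reflectionPerm i.2 hai) i
  rw [rootCoeff_reflectionPerm, Pi.add_apply, Pi.single_eq_same, hp] at h2
  omega

/-- The simple reflections commuting with `σ_i`, other than `σ_i`. -/
def nonNeighbors (i : b.support) : Set b.support := {j | j ≠ i ∧ ¬ Adjacent b i j}

include hsl in
lemma weylGroupToPerm_of_mem_parabolic {i : b.support} {u : P.weylGroup}
    (hu : u ∈ parabolic b (nonNeighbors b i)) : P.weylGroupToPerm u i = i := by
  induction hu using Subgroup.closure_induction with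
  | mem x hx =>
    obtain ⟨j, hj, rfl⟩ := hx
    rw [weylGroupToPerm_simpleReflection]
    exact reflectionPerm_of_pairingIn_eq_zero
      (pairingIn_of_not_adjacent b hsl hj.1.symm hj.2).1
  | one => simp
  | mul x y _ _ hx hy => rw [map_mul, Equiv.Perm.mul_apply, hy, hx]
  | inv x _ hx => rw [map_inv, Equiv.Perm.inv_eq_iff_eq, hx]

include hsl in
-- All elements of W_J fix α_i, whereas uσ_i makes it negative.
lemma mul_simpleReflection_notMem {i : b.support} {u : P.weylGroup}
    (hu : u ∈ parabolic b (nonNeighbors b i)) :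
    u * simpleReflection b i ∉ parabolic b (nonNeighbors b i) := by
  intro hu'
  have e := weylGroupToPerm_of_mem_parabolic b hsl hu
  have e' := weylGroupToPerm_of_mem_parabolic b hsl hu'
  have hi : b.IsPos i := RootPairing.Base.isPos_of_mem_support i.2
  have := (isPos_mul_simpleReflection_iff b u i).mp (by rwa [e'])
  rw [e] at this
  exact this hi

include hsl in
-- σ_i commutes with the other generators, so the group is the union of the cosets W_J and W_J σ_i.
lemma mem_parabolic_iff {i : b.support} {w : P.weylGroup} :
    w ∈ parabolic b {j | Adjacent b i j}ᶜ ↔ w ∈ parabolic b (nonNeighbors b i) ∨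
      w * simpleReflection b i ∈ parabolic b (nonNeighbors b i) := by
  have hle : parabolic b (nonNeighbors b i) ≤ parabolic b {j | Adjacent b i j}ᶜ :=
    Subgroup.closure_mono (Set.image_mono fun j hj => hj.2)
  have hi : simpleReflection b i ∈ parabolic b {j | Adjacent b i j}ᶜ :=
    Subgroup.subset_closure ⟨i, fun h => h.1 rfl, rfl⟩
  refine ⟨fun hw => ?_, ?_⟩
  · have step : ∀ x, ∀ j, ¬ Adjacent b i j → (x ∈ parabolic b (nonNeighbors b i) ∨
        x * simpleReflection b i ∈ parabolic b (nonNeighbors b i)) →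
        (x * simpleReflection b j ∈ parabolic b (nonNeighbors b i) ∨
        x * simpleReflection b j * simpleReflection b i ∈ parabolic b (nonNeighbors b i)) := by
      intro x j hadj hx
      by_cases hji : j = i
      · subst hji
        rw [mul_simpleReflection_cancel]
        exact hx.symm
      · have hj : simpleReflection b j ∈ parabolic b (nonNeighbors b i) :=
          Subgroup.subset_closure ⟨j, ⟨hji, hadj⟩, rfl⟩
        refine hx.imp (fun hx => mul_mem hx hj) fun hx => ?_
        rw [mul_assoc, simpleReflection_comm b
          (pairingIn_of_not_adjacent b hsl (Ne.symm hji) hadj).1, ← mul_assoc]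
        exact mul_mem hx hj
    induction hw using Subgroup.closure_induction_right with
    | one => exact Or.inl (one_mem _)
    | mul_right x _ y hy hx =>
      obtain ⟨j, hj, rfl⟩ := hy
      exact step x j hj hx
    | mul_inv_cancel x _ y hy hx =>
      obtain ⟨j, hj, rfl⟩ := hy
      rw [simpleReflection_inv]
      exact step x j hj hx
  · rintro (hw | hw)
    · exact hle hw
    · have := mul_mem (hle hw) hi
      rwa [mul_simpleReflection_cancel] at this

include hsl in
open Classical in
lemma sum_parabolic [Fintype P.weylGroup] (i : b.support) (h : P.weylGroup → RatFun b.support) :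
    ∑ w : P.weylGroup with w ∈ parabolic b {j | Adjacent b i j}ᶜ, h w
      = ∑ u : P.weylGroup with u ∈ parabolic b (nonNeighbors b i),
        (h u + h (u * simpleReflection b i)) := by
  have hf : (Finset.univ.filter fun w : P.weylGroup => w ∈ parabolic b {j | Adjacent b i j}ᶜ)
      = (Finset.univ.filter fun w => w ∈ parabolic b (nonNeighbors b i)) ∪
        (Finset.univ.filter fun w => w ∈ parabolic b (nonNeighbors b i)).image
          (· * simpleReflection b i) := by
    ext w
    simp only [Finset.mem_filter, Finset.mem_univ, true_and, Finset.mem_union, Finset.mem_image,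
      mem_parabolic_iff b hsl]
    refine or_congr Iff.rfl ⟨fun hw => ⟨_, hw, mul_simpleReflection_cancel b w i⟩, ?_⟩
    rintro ⟨u, hu, rfl⟩
    rwa [mul_simpleReflection_cancel]
  rw [hf, Finset.sum_union, Finset.sum_image (mul_left_injective _).injOn,
    Finset.sum_add_distrib]
  rw [Finset.disjoint_left]
  intro w hw hw'
  obtain ⟨u, hu, rfl⟩ := Finset.mem_image.mp hw'
  exact mul_simpleReflection_notMem b hsl (Finset.mem_filter.mp hu).2 (Finset.mem_filter.mp hw).2

include hsl h1 hmul in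
-- Pairing u with uσ_i produces (1 - y_i²)/(1 - x_i), whose numerator cancels the factor of the
-- restricted Δ at α_i. By `rootCoeff_eq_zero_of_adjacent` no other factor of the restricted Δ
-- contains x_i.
lemma limiting_condition_average [Fintype P.weylGroup] (i : b.support) :
    ∃ g : RatFun b.support, HasRestriction {j | Adjacent b i j}
        ((bigDelta b q)⁻¹ * ∑ w, h w) g ∧ IndepOf i (g * (1 - coord i)) := by
  classical
  refine ⟨_, hasRestriction_average b hq hsl h1 hmul _, ?_⟩
  have hi : (i : ι) ∈ Finset.univ.filter fun a => b.IsPos a :=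
    Finset.mem_filter.mpr ⟨Finset.mem_univ _, RootPairing.Base.isPos_of_mem_support i.2⟩
  have hu : ∀ u ∈ parabolic b (nonNeighbors b i),
      h u ∈ IntermediateField.adjoin ℂ (coord '' nonNeighbors b i) :=
    fun u hu => term_mem_adjoin b hq hsl h1 hmul hu
  have hsum : ∑ w : P.weylGroup with w ∈ parabolic b {j | Adjacent b i j}ᶜ, h w
      = (1 - rootMon b q i ^ 2) / (1 - coord i)
        * ∑ u : P.weylGroup with u ∈ parabolic b (nonNeighbors b i), h u := by
    rw [sum_parabolic b hsl, Finset.mul_sum]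
    exact Finset.sum_congr rfl fun u hu' => term_add_term b hq hsl hmul (fun hi => hi.1 rfl)
      (fun j hj => hj.2) (hu u (Finset.mem_filter.mp hu').2)
  have hone : ∀ j ∈ {j | Adjacent b i j}, rootCoeff b i j = 0 := by
    intro j hj
    rw [rootCoeff_simple, Pi.single_apply, if_neg (Ne.symm hj.1)]
  rw [hsum, restrictedDelta, ← Finset.mul_prod_erase _ _ hi, if_pos hone]
  have hd := one_sub_coord_ne_zero (σ := b.support) i
  have hd' := one_sub_rootMon_sq_ne_zero b q (RootPairing.Base.isPos_of_mem_support i.2)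
  have e : ∀ x y : RatFun b.support, ((1 - rootMon b q i ^ 2) * x)⁻¹
      * ((1 - rootMon b q i ^ 2) / (1 - coord i) * y) * (1 - coord i) = x⁻¹ * y := by
    intro x y
    rw [mul_inv]
    field_simp
  rw [e, IndepOf]
  have hle : IntermediateField.adjoin ℂ (coord '' nonNeighbors b i : Set (RatFun b.support))
      ≤ IntermediateField.adjoin ℂ (coord '' {k | k ≠ i}) :=
    IntermediateField.adjoin.mono _ _ _ (Set.image_mono fun j hj => hj.1)
  refine mul_mem (inv_mem (prod_mem fun a ha => ?_))
    (sum_mem fun u hu' => hle (hu u (Finset.mem_filter.mp hu').2))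
  simp only [Finset.mem_erase, Finset.mem_filter, Finset.mem_univ, true_and] at ha
  split_ifs with hz
  · have hai := rootCoeff_eq_zero_of_adjacent b hsl ha.2 ha.1 hz
    refine sub_mem (one_mem _) (pow_mem (prod_mem fun j _ => ?_) 2)
    by_cases hj : j = i
    · rw [hj, hai, zpow_zero]
      exact one_mem _
    · exact zpow_mem (mul_mem (IntermediateField.algebraMap_mem _ _)
        (IntermediateField.subset_adjoin ℂ _ (Set.mem_image_of_mem _ hj))) _
  · exact one_mem _

end Average

end WeylInv

end

theorem theorem3p4 {ι V N : Type*} [Fintype ι] [AddCommGroup V] [Module ℝ V]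
    [AddCommGroup N] [Module ℝ N] (P : RootPairing ι ℝ V N) [P.IsRootSystem]
    [P.IsCrystallographic] [P.IsReduced] [P.IsIrreducible] (b : P.Base)
    (hsl : b.cartanMatrix.IsSimplyLaced) (q : ℝ) (hq : 0 < q) :
    -- the substitutions `f(x) ↦ f(σ_i x)` extend to substitutions `f(x) ↦ f(w x)`, `w ∈ W`
    ∃ T : P.weylGroup → WeylInv.RatFun b.support →ₐ[ℂ] WeylInv.RatFun b.support,
      (T 1 = AlgHom.id ℂ _ ∧ (∀ v w, T (v * w) = (T w).comp (T v)) ∧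
        ∀ i, T (WeylInv.simpleReflection b i) = WeylInv.sigmaSub (WeylInv.Adjacent b) hq i) ∧
    -- the operators `f ↦ f|σ_i` extend to a right action `f ↦ f|w` of `W`
    ∃ A : P.weylGroup → WeylInv.RatFun b.support → WeylInv.RatFun b.support,
      ((∀ f, A 1 f = f) ∧ (∀ v w f, A (v * w) f = A w (A v f)) ∧
        ∀ i f, A (WeylInv.simpleReflection b i) f = WeylInv.slash (WeylInv.Adjacent b) hq i f) ∧
    ∃ f : WeylInv.RatFun b.support,
      -- `f` is the average `Δ⁻¹ ∑_w j(w, x) (1|w)`, where `j(w, x) = Δ(x) / Δ(w x)`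
      f = (WeylInv.bigDelta b q)⁻¹ *
        ∑ᶠ w : P.weylGroup, WeylInv.bigDelta b q / T w (WeylInv.bigDelta b q) * A w 1 ∧
      -- `f` is invariant
      (∀ w, A w f = f) ∧
      -- the limiting condition
      (∀ i : b.support, ∃ g : WeylInv.RatFun b.support,
        WeylInv.HasRestriction {j | WeylInv.Adjacent b i j} f g ∧
          WeylInv.IndepOf i (g * (1 - WeylInv.coord i))) ∧
      -- `f(0) = 1`
      WeylInv.HasValueAt f 0 1
    := by
  obtain ⟨T, hT1, hTm, hTs⟩ := WeylInv.exists_substitution_action b hq hsl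
  obtain ⟨A, hA1, hAm, hAs⟩ := WeylInv.exists_slash_action b hq hsl
  let _ : Fintype P.weylGroup := Fintype.ofFinite _
  have hΔ := WeylInv.bigDelta_ne_zero b hq
  have h1 : WeylInv.bigDelta b q / T 1 (WeylInv.bigDelta b q) * A 1 1 = 1 := by
    rw [hT1, hA1, AlgHom.id_apply, div_self hΔ, one_mul]
  have hmul := WeylInv.term_mul_simpleReflection b hq hsl hT1 hTm hTs hAm hAs
  refine ⟨T, ⟨hT1, hTm, hTs⟩, A, ⟨hA1, hAm, hAs⟩, _, rfl, ?_, ?_, ?_⟩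
  · intro w
    rw [finsum_eq_sum_of_fintype]
    exact WeylInv.average_invariant b hq hsl hT1 hTm hTs hA1 hAm hAs w
  · intro i
    rw [finsum_eq_sum_of_fintype]
    exact WeylInv.limiting_condition_average b hq hsl h1 hmul i
  · rw [finsum_eq_sum_of_fintype]
    exact WeylInv.hasValueAt_average b hq hsl h1 hmul
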